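/- **Setting.** On a probability space, consider individuals $i$ with regressors $x_{it}\in\mathbb R^d$ ($t=1,\dots,T$), a real fixed effect $\alpha_i$ of arbitrary distribution that may depend on the regressors, and errors $\varepsilon_{it}$. Fix $\beta\in\mathbb R^d$. Latent outcomes are denoted $y^*_{it}$; the observed ones are $y_{it}=\max\{0,y^*_{it}\}$. "$E[\xi\mid W,A]=0$" means that the conditional expectation of $\xi$ given $W$ under $P(\cdot\mid A)$ is $0$ almost surely; each such claim is made whenever $\xi$ is integrable under $P(\cdot\mid A)$. Let $t\ne s$ be two time periods and $k,m\ge 1$ integers. In (1), (2) and (5) the errors $(\varepsilon_{i1},\dots,\varepsilon_{iT})$ are jointly normal with mean zero, $\operatorname{var}\varepsilon_{it}=\sigma_t^2$, $\operatorname{cov}(\varepsilon_{it},\varepsilon_{is})=\sigma_{t,s}$ (arbitrary, possibly degenerate), and independent of $(\alpha_i,x_{i1},\dots,x_{iT})$ (in (5): of $(\alpha_i,x_{i1},\dots,x_{iT},z_{i1},\dots,z_{iT})$). **(1) Non-stationary errors.** Let $y^*_{it}=x_{it}'\beta+\alpha_i+\varepsilon_{it}$. (a) The residual $\xi_{ist}$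 defined by $$y_{it}^{*\,k+1}y_{is}^{*\,m}-y_{is}^{*\,m+1}y_{it}^{*\,k}=y_{it}^{*\,k}y_{is}^{*\,m}(x_{it}-x_{is})'\beta+k\,y_{it}^{*\,k-1}y_{is}^{*\,m}(\sigma_t^2-\sigma_{t,s})-m\,y_{is}^{*\,m-1}y_{it}^{*\,k}(\sigma_s^2-\sigma_{t,s})+\xi_{ist}$$ satisfies $E[\xi_{ist}\mid x_{it},x_{is},\,y^*_{it}>0,y^*_{is}>0]=0$. (b) Identification. Let $A_i=\{y_{it}>0,y_{is}>0\}$, let $w_i\in\mathbb R^q$ be a measurable function (the same for all $i$) of $(x_{it},x_{is})$, and put $Y_i=y_{it}^{k+1}y_{is}^m-y_{is}^{m+1}y_{it}^k$, $r_i=\bigl(y_{it}^ky_{is}^m(x_{it}-x_{is}),\;k\,y_{it}^{k-1}y_{is}^m,\;-m\,y_{is}^{m-1}y_{it}^k\bigr)\in\mathbb R^{d+2}$. Assume that the entries of $w_iY_i$ and $w_ir_i'$ are integrable under $P(\cdot\mid A_i)$. If $E[w_ir_i'\mid A_i]$ has rank $d+2$, then $\theta=\theta_0:=(\beta,\ \sigma_t^2-\sigma_{t,s},\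 \sigma_s^2-\sigma_{t,s})$ is the one and only solution in $\mathbb R^{d+2}$ of the instrumental variables equations $E[w_i(Y_i-r_i'\theta)\mid A_i]=0$. (c) Estimation. If moreover the $(\alpha_i,x_{i1},\dots,x_{iT},\varepsilon_{i1},\dots,\varepsilon_{iT})$, $i=1,2,\dots$, are independent and identically distributed, the entries of $w_iw_i'$ are integrable under $P(\cdot\mid A_i)$ and $E[w_iw_i'\mid A_i]$ is nonsingular, then under the rank condition of (b) the instrumental variables (two-stage least squares) estimator $(\hat B'\hat A^{-1}\hat B)^{-1}\hat B'\hat A^{-1}\hat c$ with $\hat A=\sum w_iw_i'$, $\hat B=\sum w_ir_i'$, $\hat c=\sum w_iY_i$, the sums being over those $i\le N$ with $y_{it}>0$ and $y_{is}>0$, converges to $\theta_0$ almost surely as $N\to\infty$. **(2) Factor loadings.** Let $y^*_{it}=x_{it}'\beta+\rho_t\alpha_i+\varepsilon_{it}$ with real $\rho_t$, $\rho_s\neq0$, and $\rho=\rho_t/\rho_s$. The residual defined by $$y_{it}^{*\,k+1}y_{is}^{*\,m}-\rho\,y_{is}^{*\,m+1}y_{it}^{*\,k}=y_{it}^{*\,k}y_{is}^{*\,m}(x_{it}-\rho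 x_{is})'\beta+k\,y_{it}^{*\,k-1}y_{is}^{*\,m}(\sigma_t^2-\rho\sigma_{t,s})-m\,y_{is}^{*\,m-1}y_{it}^{*\,k}(\rho\sigma_s^2-\sigma_{t,s})+\xi_{ist}$$ satisfies $E[\xi_{ist}\mid x_{it},x_{is},\,y^*_{it}>0,y^*_{is}>0]=0$. **(3) Individual-specific variances.** Let $y^*_{it}=x_{it}'\beta+\alpha_i+\varepsilon_{it}$ where, conditionally on $(\alpha_i,x_{i1},\dots,x_{iT},\sigma_i^2)$, the $\varepsilon_{it}$ are independent over $t$ with law $N(0,\sigma_i^2)$; $\sigma_i^2$ may be random. The residual defined as in (1)(a), with both $\sigma_t^2-\sigma_{t,s}$ and $\sigma_s^2-\sigma_{t,s}$ replaced by $\sigma_i^2$, satisfies $E[\xi_{ist}\mid x_{it},x_{is},y^*_{it}>0,y^*_{is}>0]=0$. For three distinct periods $t,s,\tau$, the residual defined by $$\begin{aligned}&(y_{it}^{*2}y^*_{is}-y_{is}^{*2}y^*_{it})+(y_{is}^{*2}y^*_{i\tau}-y_{i\tau}^{*2}y^*_{is})+(y_{i\tau}^{*2}y^*_{it}-y_{it}^{*2}y^*_{i\tau})\\&=\bigl(y^*_{it}y^*_{is}(x_{it}-x_{is})+y^*_{is}y^*_{i\tau}(x_{is}-x_{i\tau})+y^*_{i\tau}y^*_{it}(x_{i\tau}-x_{it})\bigr)'\beta+\xi_{ist\tau}\end{aligned}$$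 satisfies $E[\xi_{ist\tau}\mid x_{it},x_{is},x_{i\tau},\,y^*_{it}>0,y^*_{is}>0,y^*_{i\tau}>0]=0$. **(4) Additive variances.** Suppose instead that, conditionally on $(\alpha_i,x_{i1},\dots,x_{iT},\sigma_i^2)$, the $\varepsilon_{it}$ are independent over $t$ with law $N(0,\sigma_i^2+\sigma_t^2)$, where $\sigma_t^2$ is a constant depending on $t$ only. The same conclusions hold with $\sigma_t^2-\sigma_{t,s}$ and $\sigma_s^2-\sigma_{t,s}$ in (1)(a) replaced by $\sigma_i^2+\sigma_t^2$ and $\sigma_i^2+\sigma_s^2$, and with the terms $(y^*_{i\tau}-y^*_{it})\sigma_s^2+(y^*_{is}-y^*_{i\tau})\sigma_t^2+(y^*_{it}-y^*_{is})\sigma_\tau^2$ added to the right-hand side of the three-period equation in (3). **(5) Fixed effects in the slopes.** Let $y^*_{it}=x_{it}'\beta+z_{it}\alpha_i+\varepsilon_{it}$ with $z_{it}$ a real observed regressor. Put $u_t=y^*_{it}z_{is}$ and $u_s=y^*_{is}z_{it}$. The residual defined by $$u_t^{k+1}u_s^m-u_s^{m+1}u_t^k=u_t^ku_s^m(z_{is}x_{it}-z_{it}x_{is})'\beta+k\,u_t^{k-1}u_s^m(z_{is}^2\sigma_t^2-z_{it}z_{is}\sigma_{t,s})-m\,u_s^{m-1}u_t^k(z_{it}^2\sigma_s^2-z_{it}z_{is}\sigma_{t,s})+\xi_{ist}$$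 satisfies $E[\xi_{ist}\mid z_{it},z_{is},x_{it},x_{is},\,y^*_{it}>0,y^*_{is}>0]=0$. -/

import Mathlib

open MeasureTheory ProbabilityTheory Filter Topology
open scoped Matrix

namespace PanelTobit

/-- The latent outcome `y* = x'β + c + ε`, where `c` is the contribution of the fixed effect
(`α`, `ρ_t α` or `z_t α`). -/
def latent {Ω : Type*} {d : ℕ} (β : Fin d → ℝ) (x : Ω → Fin d → ℝ) (c ε : Ω → ℝ) : Ω → ℝ :=
  fun ω => x ω ⬝ᵥ β + c ω + ε ω

/-- The observed outcome, censored from below at zero: `y = max {0, y*}`. -/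
noncomputable def censor {Ω : Type*} (y : Ω → ℝ) : Ω → ℝ := fun ω => max 0 (y ω)

/-- The event that two outcomes are both positive. -/
def bothPos {Ω : Type*} (y y' : Ω → ℝ) : Set Ω := {ω | 0 < y ω ∧ 0 < y' ω}

/-- The event that three outcomes are all positive. -/
def allPos {Ω : Type*} (y y' y'' : Ω → ℝ) : Set Ω := {ω | 0 < y ω ∧ 0 < y' ω ∧ 0 < y'' ω}

/-- `E[ξ | W, A] = 0` for an event `A` and a random element `W`: under the conditional
probability `μ(· | A)`, the conditional expectation of `ξ` given `σ(W)` vanishes a.s.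
This is used only for `ξ` that is integrable under `μ(· | A)`. -/
def CondMeanZero {Ω 𝓦 : Type*} [MeasurableSpace Ω] [MeasurableSpace 𝓦] (μ : Measure Ω)
    (A : Set Ω) (W : Ω → 𝓦) (ξ : Ω → ℝ) : Prop :=
  (μ[|A])[ξ | MeasurableSpace.comap W inferInstance] =ᵐ[μ[|A]] 0

/-- The errors `(ε_1, …, ε_T)` are jointly normal with mean zero and covariances `σ_{t,s} = S t s`
(so `σ_t² = S t t`), and independent of `Z` (regressors and fixed effect).
Degenerate covariance matrices are allowed. -/
structure NormalErrors {Ω 𝓩 : Type*} [MeasurableSpace Ω] [MeasurableSpace 𝓩] {T : ℕ}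
    (μ : Measure Ω) (Z : Ω → 𝓩) (ε : Fin T → Ω → ℝ) (S : Matrix (Fin T) (Fin T) ℝ) : Prop where
  measurable : ∀ t, Measurable (ε t)
  gaussian : HasGaussianLaw (fun ω t => ε t ω) μ
  mean : ∀ t, ∫ ω, ε t ω ∂μ = 0
  cov : ∀ t s, cov[ε t, ε s; μ] = S t s
  indep : IndepFun (fun ω t => ε t ω) Z μ

/-- The errors are, conditionally on `Z` (regressors and fixed effect) and on the individual
variance component `a`, independent over time and normal with mean zero, the one of period `t`
having variance `a + v t`. For `v = 0` they are conditionally i.i.d. `N(0, a)`. -/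
structure IndividualVarianceErrors {Ω 𝓩 : Type*} [MeasurableSpace Ω] [MeasurableSpace 𝓩] {T : ℕ}
    (μ : Measure Ω) [IsFiniteMeasure μ] (Z : Ω → 𝓩) (a : Ω → ℝ) (v : Fin T → ℝ)
    (ε : Fin T → Ω → ℝ) : Prop where
  measurable : ∀ t, Measurable (ε t)
  measurable_var : Measurable a
  nonneg : ∀ᵐ ω ∂μ, ∀ t, 0 ≤ a ω + v t
  condLaw : ∀ᵐ ω ∂μ, condDistrib (fun ω t => ε t ω) (fun ω => (Z ω, a ω)) μ (Z ω, a ω)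
    = Measure.pi (fun t => gaussianReal 0 (a ω + v t).toNNReal)

/-- The residual `ξ` defined by
`y^(k+1) y'^m - y'^(m+1) y^k = y^k y'^m b + k y^(k-1) y'^m c - m y'^(m-1) y^k c' + ξ`. -/
def residual (k m : ℕ) (y y' b c c' : ℝ) : ℝ :=
  (y ^ (k + 1) * y' ^ m - y' ^ (m + 1) * y ^ k)
    - (y ^ k * y' ^ m * b + k * y ^ (k - 1) * y' ^ m * c - m * y' ^ (m - 1) * y ^ k * c')

/-- The residual `ξ` of the factor-loading model, `ρ` being the ratio of the loadings:
`y^(k+1) y'^m - y'^(m+1) y^k ρ = y^k y'^m b + k y^(k-1) y'^m c - m y'^(m-1) y^k c' + ξ`. -/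
def loadingResidual (k m : ℕ) (ρ y y' b c c' : ℝ) : ℝ :=
  (y ^ (k + 1) * y' ^ m - y' ^ (m + 1) * y ^ k * ρ)
    - (y ^ k * y' ^ m * b + k * y ^ (k - 1) * y' ^ m * c - m * y' ^ (m - 1) * y ^ k * c')

/-- `(y² y' - y'² y) + (y'² y'' - y''² y') + (y''² y - y² y'')`. -/
def tripleLhs (y y' y'' : ℝ) : ℝ :=
  (y ^ 2 * y' - y' ^ 2 * y) + (y' ^ 2 * y'' - y'' ^ 2 * y') + (y'' ^ 2 * y - y ^ 2 * y'')

/-- `(y y' (x - x') + y' y'' (x' - x'') + y'' y (x'' - x))' β`. -/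
def tripleReg {d : ℕ} (β : Fin d → ℝ) (y y' y'' : ℝ) (x x' x'' : Fin d → ℝ) : ℝ :=
  ((y * y') • (x - x') + (y' * y'') • (x' - x'') + (y'' * y) • (x'' - x)) ⬝ᵥ β

/-- Dependent variable of the instrumental variables equation. -/
def ivOutcome (k m : ℕ) (y y' : ℝ) : ℝ := y ^ (k + 1) * y' ^ m - y' ^ (m + 1) * y ^ k

/-- Regressors of the instrumental variables equation, multiplying `(β, c, c')`. -/
def ivRegressor {d : ℕ} (k m : ℕ) (y y' : ℝ) (x x' : Fin d → ℝ) : Fin d ⊕ Fin 2 → ℝ :=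
  Sum.elim ((y ^ k * y' ^ m) • (x - x'))
    ![k * y ^ (k - 1) * y' ^ m, -(m * y' ^ (m - 1) * y ^ k)]

/-- The parameter vector `(β, σ_t² - σ_{t,s}, σ_s² - σ_{t,s})`. -/
def ivParam {T d : ℕ} (β : Fin d → ℝ) (S : Matrix (Fin T) (Fin T) ℝ) (t s : Fin T) :
    Fin d ⊕ Fin 2 → ℝ :=
  Sum.elim β ![S t t - S t s, S s s - S t s]

/-- The matrix `E[w r' | A]`. -/
noncomputable def condMoment {Ω Q P : Type*} [MeasurableSpace Ω] (μ : Measure Ω) (A : Set Ω)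
    (w : Ω → Q → ℝ) (r : Ω → P → ℝ) : Matrix Q P ℝ :=
  Matrix.of fun j l => ∫ ω, w ω j * r ω l ∂(μ[|A])

/-- The linear instrumental variables (two-stage least squares) estimator based on the
observations `i ∈ I`, with outcomes `y i`, regressors `r i` and instruments `w i`. -/
noncomputable def ivEstimator {ι Q P : Type*} [Fintype Q] [DecidableEq Q] [Fintype P]
    [DecidableEq P] (I : Finset ι) (w : ι → Q → ℝ) (r : ι → P → ℝ) (y : ι → ℝ) : P → ℝ :=
  let A : Matrix Q Q ℝ := ∑ i ∈ I, Matrix.vecMulVec (w i) (w i)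
  let B : Matrix Q P ℝ := ∑ i ∈ I, Matrix.vecMulVec (w i) (r i)
  let c : Q → ℝ := ∑ i ∈ I, y i • w i
  (Bᵀ * A⁻¹ * B)⁻¹ *ᵥ ((Bᵀ * A⁻¹) *ᵥ c)

end PanelTobit

namespace PanelTobit

open scoped NNReal

/-- The integral of the derivative of a function vanishing at infinity is zero; the function may
fail to be differentiable on a countable set. -/
theorem integral_eq_zero_of_hasDerivAt_off_countable {f f' : ℝ → ℝ} {s : Set ℝ}
    (hs : s.Countable) (hf : Continuous f) (hderiv : ∀ x ∉ s, HasDerivAt f (f' x) x)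
    (hint : Integrable f') (hlim : Tendsto f (cocompact ℝ) (𝓝 0)) : ∫ x, f' x = 0 := by
  have h1 : Tendsto (fun n : ℝ => ∫ x in (-n)..n, f' x) atTop (𝓝 (∫ x, f' x)) :=
    intervalIntegral_tendsto_integral hint tendsto_neg_atTop_atBot tendsto_id
  have h2 : ∀ n : ℝ, ∫ x in (-n)..n, f' x = f n - f (-n) := fun n =>
    integral_eq_of_hasDerivAt_off_countable f f' hs hf.continuousOn
      (fun x hx => hderiv x hx.2) hint.intervalIntegrable
  rw [cocompact_eq_atBot_atTop, tendsto_sup] at hlim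
  have h3 : Tendsto (fun n : ℝ => f n - f (-n)) atTop (𝓝 (0 - 0)) :=
    hlim.2.sub (hlim.1.comp tendsto_neg_atTop_atBot)
  simp only [h2] at h1
  simpa using tendsto_nhds_unique h1 h3

theorem gaussianPDFReal_zero_mean_eq (v : ℝ≥0) (x : ℝ) :
    gaussianPDFReal 0 v x = (√(2 * Real.pi * v))⁻¹ * Real.exp (-(2 * (v : ℝ))⁻¹ * x ^ 2) := by
  rw [gaussianPDFReal]
  congr 2
  simp [div_eq_inv_mul]

theorem hasDerivAt_gaussianPDFReal {v : ℝ≥0} (hv : v ≠ 0) (x : ℝ) :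
    HasDerivAt (gaussianPDFReal 0 v) (-(x / v) * gaussianPDFReal 0 v x) x := by
  have hv' : (v : ℝ) ≠ 0 := by exact_mod_cast hv
  have h := ((((hasDerivAt_id x).pow 2).const_mul (-(2 * (v : ℝ))⁻¹)).exp).const_mul
    (√(2 * Real.pi * v))⁻¹
  have e : gaussianPDFReal 0 v
      = fun x => (√(2 * Real.pi * v))⁻¹ * Real.exp (-(2 * (v : ℝ))⁻¹ * (id ^ 2 : ℝ → ℝ) x) := by
    funext y
    simp [gaussianPDFReal_zero_mean_eq]
  rw [e]
  refine h.congr_deriv ?_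
  simp only [Pi.pow_apply, id]
  field_simp
  simp

theorem tendsto_gaussianPDFReal_mul_eval {v : ℝ≥0} (hv : v ≠ 0) (P : Polynomial ℝ) :
    Tendsto (fun x => gaussianPDFReal 0 v x * P.eval x) (cocompact ℝ) (𝓝 0) := by
  have hv' : 0 < (2 * (v : ℝ))⁻¹ := by positivity
  induction P using Polynomial.induction_on' with
  | add p q hp hq => simpa [mul_add] using hp.add hq
  | monomial n a =>
    have h := (tendsto_rpow_abs_mul_exp_neg_mul_sq_cocompact hv' n).const_mul
      (|(√(2 * Real.pi * v))⁻¹| * |a|)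
    rw [mul_zero] at h
    rw [tendsto_zero_iff_abs_tendsto_zero]
    refine h.congr fun x => ?_
    simp only [Function.comp, gaussianPDFReal_zero_mean_eq, Polynomial.eval_monomial, abs_mul,
      Real.rpow_natCast, abs_pow, Real.abs_exp]
    ring

theorem integrable_gaussianPDFReal_mul_eval {v : ℝ≥0} (hv : v ≠ 0) (P : Polynomial ℝ) :
    Integrable (fun x => gaussianPDFReal 0 v x * P.eval x) := by
  have hv' : 0 < (2 * (v : ℝ))⁻¹ := by positivity
  induction P using Polynomial.induction_on' with
  | add p q hp hq =>
    simp only [Polynomial.eval_add, mul_add]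
    exact hp.add hq
  | monomial n a =>
    have h := (integrable_rpow_mul_exp_neg_mul_sq hv' (s := n)
      (by have : (0 : ℝ) ≤ n := n.cast_nonneg
          linarith)).const_mul ((√(2 * Real.pi * v))⁻¹ * a)
    refine h.congr (ae_of_all _ fun x => ?_)
    simp only [gaussianPDFReal_zero_mean_eq, Polynomial.eval_monomial, Real.rpow_natCast]
    ring

open Polynomial in
/-- Gaussian integration by parts for a polynomial that is cut off outside an open set on whose
boundary it vanishes. -/
theorem integral_indicator_gaussianReal_eq_zero {v : ℝ≥0} (hv : v ≠ 0) (P : ℝ[X]) {U : Set ℝ}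
    (hU : IsOpen U) (hcont : Continuous (U.indicator fun x => P.eval x))
    (hfr : (frontier U).Countable) :
    ∫ x, U.indicator (fun x => x * P.eval x - v * P.derivative.eval x) x ∂(gaussianReal 0 v) = 0 := by
  have hv' : (v : ℝ) ≠ 0 := by exact_mod_cast hv
  rw [integral_gaussianReal_eq_integral_smul hv]
  have hpdf : Continuous (gaussianPDFReal 0 v) :=
    continuous_iff_continuousAt.2 fun x => (hasDerivAt_gaussianPDFReal hv x).continuousAt
  have key := integral_eq_zero_of_hasDerivAt_off_countable hfr (hpdf.mul hcont)
    (f' := fun x => U.indicator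
      (fun x => gaussianPDFReal 0 v x * (-(C (v : ℝ)⁻¹ * X * P) + P.derivative).eval x) x) ?_ ?_ ?_
  · have h2 : ∀ x, gaussianPDFReal 0 v x • U.indicator
        (fun x => x * P.eval x - v * P.derivative.eval x) x
        = -v * U.indicator (fun x => gaussianPDFReal 0 v x *
          (-(C (v : ℝ)⁻¹ * X * P) + P.derivative).eval x) x := by
      intro x
      by_cases hx : x ∈ U
      · simp only [Set.indicator_of_mem hx, smul_eq_mul, eval_add, eval_neg, eval_mul, eval_C,
          eval_X]
        field_simp
        ring
      · simp [Set.indicator_of_notMem hx]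
    simp only [h2]
    rw [integral_const_mul, key, mul_zero]
  · intro x hx
    by_cases hxU : x ∈ U
    · have h := (hasDerivAt_gaussianPDFReal hv x).mul (P.hasDerivAt x)
      refine (h.congr_of_eventuallyEq ?_).congr_deriv ?_
      · filter_upwards [hU.mem_nhds hxU] with y hy
        simp [Set.indicator_of_mem hy]
      · simp only [Set.indicator_of_mem hxU, eval_add, eval_neg, eval_mul, eval_C, eval_X]
        field_simp
    · have hxc : x ∈ (closure U)ᶜ := by
        intro h
        exact hx ⟨h, by rwa [hU.interior_eq]⟩
      rw [Set.indicator_of_notMem hxU]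
      refine (hasDerivAt_const x (0 : ℝ)).congr_of_eventuallyEq ?_
      filter_upwards [isClosed_closure.isOpen_compl.mem_nhds hxc] with y hy
      have : y ∉ U := fun h => hy (subset_closure h)
      simp [Set.indicator_of_notMem this]
  · exact (integrable_gaussianPDFReal_mul_eval hv _).indicator hU.measurableSet
  · have h0 := (tendsto_gaussianPDFReal_mul_eval hv P).norm
    rw [norm_zero] at h0
    refine squeeze_zero_norm (fun x => ?_) h0
    by_cases hx : x ∈ U
    · simp [Set.indicator_of_mem hx]
    · simpa [Set.indicator_of_notMem hx] using by positivity

theorem indicator_pos_affine_eq {r₁ a r₂ b x : ℝ} {k m : ℕ} (hk : 1 ≤ k) (hm : 1 ≤ m) :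
    {x | 0 < r₁ + a * x ∧ 0 < r₂ + b * x}.indicator
        (fun x => (r₁ + a * x) ^ k * (r₂ + b * x) ^ m) x
      = max 0 (r₁ + a * x) ^ k * max 0 (r₂ + b * x) ^ m := by
  by_cases h1 : 0 < r₁ + a * x
  · by_cases h2 : 0 < r₂ + b * x
    · simp [Set.indicator, h1, h2, max_eq_right h1.le, max_eq_right h2.le]
    · simp [Set.indicator, h2, max_eq_left (not_lt.1 h2), zero_pow (by omega : m ≠ 0)]
  · simp [Set.indicator, h1, max_eq_left (not_lt.1 h1), zero_pow (by omega : k ≠ 0)]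

theorem countable_frontier_pos_affine (r₁ a r₂ b : ℝ) :
    (frontier {x | 0 < r₁ + a * x ∧ 0 < r₂ + b * x}).Countable := by
  have half : ∀ r a : ℝ, (frontier {x | 0 < r + a * x}).Countable := by
    intro r a
    by_cases ha : a = 0
    · subst ha
      by_cases hr : 0 < r <;> simp [hr]
    · refine (Set.countable_singleton (-r / a)).mono fun x hx => ?_
      have := frontier_lt_subset_eq (continuous_const (y := (0 : ℝ)))
        (by fun_prop : Continuous fun x => r + a * x) hx
      simp only [Set.mem_ofPred_eq] at this
      rw [Set.mem_singleton_iff]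
      field_simp
      linarith
  refine ((half r₁ a).union (half r₂ b)).mono ?_
  rw [Set.ofPred_and]
  exact (frontier_inter_subset _ _).trans
    (Set.union_subset_union Set.inter_subset_left Set.inter_subset_right)

open Polynomial in
/-- Gaussian integration by parts along a line, for the monomial `y₁ ^ k * y₂ ^ m` restricted to
the positive quadrant. -/
theorem integral_indicator_pos_affine_gaussianReal (v : ℝ≥0) (r₁ a r₂ b : ℝ) {k m : ℕ}
    (hk : 1 ≤ k) (hm : 1 ≤ m) :
    ∫ x, {x | 0 < r₁ + a * x ∧ 0 < r₂ + b * x}.indicator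
      (fun x => x * ((r₁ + a * x) ^ k * (r₂ + b * x) ^ m)
        - v * (k * (r₁ + a * x) ^ (k - 1) * (r₂ + b * x) ^ m * a
          + m * (r₁ + a * x) ^ k * (r₂ + b * x) ^ (m - 1) * b)) x ∂(gaussianReal 0 v) = 0 := by
  by_cases hv : v = 0
  · subst hv
    rw [gaussianReal_zero_var, integral_dirac]
    simp [Set.indicator]
  have h := integral_indicator_gaussianReal_eq_zero hv
    ((C r₁ + C a * X) ^ k * (C r₂ + C b * X) ^ m)
    (U := {x | 0 < r₁ + a * x ∧ 0 < r₂ + b * x}) ?_ ?_ (countable_frontier_pos_affine r₁ a r₂ b)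
  · refine Eq.trans ?_ h
    refine integral_congr_ae (ae_of_all _ fun x => ?_)
    refine congrArg (fun f : ℝ → ℝ => Set.indicator _ f x) (_root_.funext fun x => ?_)
    simp only [eval_mul, eval_pow, eval_add, eval_C, eval_X, derivative_mul, derivative_pow,
      derivative_add, derivative_C, derivative_X, zero_mul, zero_add, mul_one]
    ring
  · exact (isOpen_lt (f := fun _ => 0) (g := fun x => r₁ + a * x) (by fun_prop) (by fun_prop)).inter
      (isOpen_lt (f := fun _ => 0) (g := fun x => r₂ + b * x) (by fun_prop) (by fun_prop))
  · have e : ({x | 0 < r₁ + a * x ∧ 0 < r₂ + b * x}.indicator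
        fun x => ((C r₁ + C a * X) ^ k * (C r₂ + C b * X) ^ m : ℝ[X]).eval x)
        = fun x => max 0 (r₁ + a * x) ^ k * max 0 (r₂ + b * x) ^ m := by
      funext x
      rw [← indicator_pos_affine_eq hk hm]
      simp
    rw [e]
    fun_prop

end PanelTobit

namespace PanelTobit

/-- `ν` is the centered Gaussian law with covariance matrix `S`. -/
structure IsCenteredGaussian {T : ℕ} (ν : Measure (Fin T → ℝ)) (S : Matrix (Fin T) (Fin T) ℝ) :
    Prop where
  gaussian : IsGaussian ν
  mean : ∀ t, ∫ e, e t ∂ν = 0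
  cov : ∀ t s, cov[fun e => e t, fun e => e s; ν] = S t s

namespace IsCenteredGaussian

variable {T : ℕ} {ν : Measure (Fin T → ℝ)} {S : Matrix (Fin T) (Fin T) ℝ}

theorem memLp_eval (h : IsCenteredGaussian ν S) (i : Fin T) {r : ENNReal} (hr : r ≠ ⊤) :
    MemLp (fun e : Fin T → ℝ => e i) r ν := by
  have := h.gaussian
  exact ((IsGaussian.hasGaussianLaw_id (μ := ν)).eval i).memLp hr

theorem mean_comb (h : IsCenteredGaussian ν S) (t s : Fin T) (p q : ℝ) :
    ∫ e, (p * e t - q * e s) ∂ν = 0 := by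
  have := h.gaussian
  have hi : ∀ i, Integrable (fun e : Fin T → ℝ => e i) ν := fun i =>
    memLp_one_iff_integrable.1 (h.memLp_eval i (by simp))
  rw [integral_sub ((hi t).const_mul p) ((hi s).const_mul q), integral_const_mul,
    integral_const_mul, h.mean, h.mean]
  simp

theorem cov_comb (h : IsCenteredGaussian ν S) (i t s : Fin T) (p q : ℝ) :
    cov[fun e => e i, fun e => p * e t - q * e s; ν] = p * S i t - q * S i s := by
  have := h.gaussian
  have hL : ∀ i, MemLp (fun e : Fin T → ℝ => e i) 2 ν := fun i => h.memLp_eval i (by simp)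
  rw [covariance_fun_sub_right (hL i) ((hL t).const_mul p) ((hL s).const_mul q),
    covariance_const_mul_right, covariance_const_mul_right, h.cov, h.cov]

theorem map_comb (h : IsCenteredGaussian ν S) (t s : Fin T) (p q : ℝ) :
    ν.map (fun e => p * e t - q * e s)
      = gaussianReal 0 (Var[fun e => p * e t - q * e s; ν]).toNNReal := by
  have := h.gaussian
  let D : (Fin T → ℝ) →L[ℝ] ℝ := p • ContinuousLinearMap.proj t - q • ContinuousLinearMap.proj s
  have hg : HasGaussianLaw (fun e : Fin T → ℝ => p * e t - q * e s) ν :=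
    (IsGaussian.hasGaussianLaw_id (μ := ν)).map_fun D
  rw [hg.map_eq_gaussianReal, h.mean_comb]

theorem var_mul_regression (h : IsCenteredGaussian ν S) (i t s : Fin T) (p q : ℝ) :
    Var[fun e => p * e t - q * e s; ν]
      * ((p * S i t - q * S i s) / Var[fun e => p * e t - q * e s; ν]) = p * S i t - q * S i s := by
  have := h.gaussian
  by_cases hv : Var[fun e => p * e t - q * e s; ν] = 0
  · have hmap := h.map_comb t s p q
    rw [hv, Real.toNNReal_zero, gaussianReal_zero_var] at hmap
    have hD : ∀ᵐ e ∂ν, p * e t - q * e s = 0 := by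
      refine ae_of_ae_map (f := fun e : Fin T → ℝ => p * e t - q * e s) (p := fun x => x = 0)
        (by fun_prop) ?_
      rw [hmap, ae_dirac_eq]
      simp
    rw [← h.cov_comb i t s p q, covariance, h.mean_comb, hv, zero_mul]
    symm
    refine integral_eq_zero_of_ae ?_
    filter_upwards [hD] with e he
    simp [he]
  · field_simp

theorem indepFun_residual (h : IsCenteredGaussian ν S) (t s : Fin T) (p q : ℝ) :
    IndepFun (fun (e : Fin T → ℝ) i => e i - (p * S i t - q * S i s)
        / Var[fun e => p * e t - q * e s; ν] * (p * e t - q * e s))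
      (fun e => p * e t - q * e s) ν := by
  have := h.gaussian
  have hL : ∀ i, MemLp (fun e : Fin T → ℝ => e i) 2 ν := fun i => h.memLp_eval i (by simp)
  have hD : MemLp (fun e : Fin T → ℝ => p * e t - q * e s) 2 ν :=
    ((hL t).const_mul p).sub ((hL s).const_mul q)
  let D : (Fin T → ℝ) →L[ℝ] ℝ := p • ContinuousLinearMap.proj t - q • ContinuousLinearMap.proj s
  have hg := (IsGaussian.hasGaussianLaw_id (μ := ν)).map_fun
    (((ContinuousLinearMap.pi fun i => ContinuousLinearMap.proj i - ((p * S i t - q * S i s)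
      / Var[fun e => p * e t - q * e s; ν]) • D) : (Fin T → ℝ) →L[ℝ] (Fin T → ℝ)).prod
      (ContinuousLinearMap.pi fun _ : Fin 1 => D))
  have hi := hg.indepFun_of_covariance_eval
    (X := fun i (e : Fin T → ℝ) => e i - (p * S i t - q * S i s)
        / Var[fun e => p * e t - q * e s; ν] * (p * e t - q * e s))
    (Y := fun _ e => p * e t - q * e s) ?_
  · exact hi.comp measurable_id (measurable_pi_apply 0)
  · intro i _
    rw [covariance_fun_sub_left (hL i) (hD.const_mul _) hD, covariance_const_mul_left,
      covariance_self hD.aemeasurable, h.cov_comb, sub_eq_zero, mul_comm _ (Var[_; _]),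
      h.var_mul_regression]

/-- Gaussian integration by parts in the direction in which `(e t, e s)` covaries with
`p * e t - q * e s`, on the event that some outcomes are positive. -/
theorem integral_eq_zero (h : IsCenteredGaussian ν S) (t s : Fin T) (p q : ℝ) (c : Fin T → ℝ)
    (J : Finset (Fin T)) (hJ : ∀ j ∈ J, p * S j t - q * S j s = 0) {k m : ℕ}
    (hk : 1 ≤ k) (hm : 1 ≤ m) :
    ∫ e, {e : Fin T → ℝ | (0 < c t + e t ∧ 0 < c s + e s) ∧ ∀ j ∈ J, 0 < c j + e j}.indicator
      (fun e => (p * e t - q * e s) * ((c t + e t) ^ k * (c s + e s) ^ m)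
        - (k * (c t + e t) ^ (k - 1) * (c s + e s) ^ m * (p * S t t - q * S t s)
          + m * (c t + e t) ^ k * (c s + e s) ^ (m - 1) * (p * S s t - q * S s s))) e ∂ν = 0 := by
  have := h.gaussian
  set V := Var[fun e => p * e t - q * e s; ν] with hV
  set a : Fin T → ℝ := fun i => (p * S i t - q * S i s) / V with ha
  have hVa : ∀ i, V * a i = p * S i t - q * S i s := fun i => h.var_mul_regression i t s p q
  have haJ : ∀ j ∈ J, a j = 0 := fun j hj => by simp [ha, hJ j hj]
  let R : (Fin T → ℝ) → (Fin T → ℝ) := fun e i => e i - a i * (p * e t - q * e s)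
  let D : (Fin T → ℝ) → ℝ := fun e => p * e t - q * e s
  have hRm : Measurable R := by fun_prop
  have hDm : Measurable D := by fun_prop
  have hind : IndepFun R D ν := h.indepFun_residual t s p q
  rw [indepFun_iff_map_prod_eq_prod_map_map hRm.aemeasurable hDm.aemeasurable] at hind
  let F : (Fin T → ℝ) × ℝ → ℝ := fun z =>
    {z : (Fin T → ℝ) × ℝ | (0 < (c t + z.1 t) + a t * z.2 ∧ 0 < (c s + z.1 s) + a s * z.2)
        ∧ ∀ j ∈ J, 0 < c j + z.1 j}.indicator
      (fun z => z.2 * (((c t + z.1 t) + a t * z.2) ^ k * ((c s + z.1 s) + a s * z.2) ^ m)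
        - V * (k * ((c t + z.1 t) + a t * z.2) ^ (k - 1) * ((c s + z.1 s) + a s * z.2) ^ m * a t
          + m * ((c t + z.1 t) + a t * z.2) ^ k * ((c s + z.1 s) + a s * z.2) ^ (m - 1) * a s)) z
  have hset : MeasurableSet {z : (Fin T → ℝ) × ℝ |
      (0 < (c t + z.1 t) + a t * z.2 ∧ 0 < (c s + z.1 s) + a s * z.2)
        ∧ ∀ j ∈ J, 0 < c j + z.1 j} := by
    have hpos : ∀ i, MeasurableSet {z : (Fin T → ℝ) × ℝ | 0 < (c i + z.1 i) + a i * z.2} :=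
      fun i => measurableSet_lt measurable_const (by fun_prop)
    refine ((hpos t).inter (hpos s)).inter ?_
    have : {z : (Fin T → ℝ) × ℝ | ∀ j ∈ J, 0 < c j + z.1 j}
        = ⋂ j ∈ J, {z : (Fin T → ℝ) × ℝ | 0 < c j + z.1 j} := by ext; simp
    change MeasurableSet {z : (Fin T → ℝ) × ℝ | ∀ j ∈ J, 0 < c j + z.1 j}
    rw [this]
    exact J.measurableSet_biInter fun j _ => measurableSet_lt measurable_const (by fun_prop)
  have hFm : Measurable F := Measurable.indicator (by fun_prop) hset
  have hF : ∀ e, {e : Fin T → ℝ | (0 < c t + e t ∧ 0 < c s + e s)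
      ∧ ∀ j ∈ J, 0 < c j + e j}.indicator
      (fun e => (p * e t - q * e s) * ((c t + e t) ^ k * (c s + e s) ^ m)
        - (k * (c t + e t) ^ (k - 1) * (c s + e s) ^ m * (p * S t t - q * S t s)
          + m * (c t + e t) ^ k * (c s + e s) ^ (m - 1) * (p * S s t - q * S s s))) e
      = F (R e, D e) := by
    intro e
    have h1 : ∀ i, c i + R e i + a i * D e = c i + e i := fun i => by simp only [R, D]; ring
    have h2 : (∀ j ∈ J, 0 < c j + R e j) ↔ ∀ j ∈ J, 0 < c j + e j :=
      forall₂_congr fun j hj => by simp [R, haJ j hj]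
    simp only [F, Set.indicator, Set.mem_ofPred_eq, h1, h2]
    refine if_congr Iff.rfl ?_ rfl
    rw [← hVa, ← hVa]
    simp only [D]
    ring
  simp only [hF]
  rw [← integral_map (φ := fun e => (R e, D e)) (hRm.prodMk hDm).aemeasurable
    hFm.aestronglyMeasurable, hind]
  by_cases hint : Integrable F ((ν.map R).prod (ν.map D))
  · rw [integral_prod _ hint]
    refine integral_eq_zero_of_ae (ae_of_all _ fun r => ?_)
    simp only [D, h.map_comb t s p q]
    by_cases hr : ∀ j ∈ J, 0 < c j + r j
    · have := integral_indicator_pos_affine_gaussianReal V.toNNReal (c t + r t) (a t) (c s + r s)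
        (a s) hk hm
      rw [Real.coe_toNNReal V (variance_nonneg _ _)] at this
      refine Eq.trans (integral_congr_ae (ae_of_all _ fun y => ?_)) this
      simp only [F, Set.indicator, Set.mem_ofPred_eq, and_iff_left hr]
    · simp [F, Set.indicator, hr]
  · exact integral_undef hint

end IsCenteredGaussian

end PanelTobit

namespace PanelTobit

section Disintegration

variable {Ω 𝓩 𝓦 : Type*} [MeasurableSpace Ω] [MeasurableSpace 𝓩] [MeasurableSpace 𝓦]
  {μ : Measure Ω}

theorem integral_cond_eq_inv_mul {A : Set Ω} (f : Ω → ℝ) :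
    ∫ ω, f ω ∂(μ[|A]) = (μ.real A)⁻¹ * ∫ ω in A, f ω ∂μ := by
  rw [ProbabilityTheory.cond, integral_smul_measure, ENNReal.toReal_inv, smul_eq_mul, Measure.real]

theorem condMeanZero_of_forall_setIntegral_eq_zero {A : Set Ω} {W : Ω → 𝓦} (hW : Measurable W) {ξ : Ω → ℝ}
    (hint : Integrable ξ (μ[|A]))
    (h : ∀ C : Set 𝓦, MeasurableSet C → ∫ ω in A, C.indicator 1 (W ω) * ξ ω ∂μ = 0) :
    CondMeanZero μ A W ξ := by
  refine (ae_eq_condExp_of_forall_setIntegral_eq hW.comap_le hint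
    (fun _ _ _ => integrableOn_zero) ?_ aestronglyMeasurable_zero).symm
  rintro _ ⟨C, hC, rfl⟩ -
  have e : ∀ ω, C.indicator 1 (W ω) * ξ ω = (W ⁻¹' C).indicator ξ ω := by
    intro ω
    by_cases hω : W ω ∈ C <;> simp [Set.indicator, hω]
  have h' := h C hC
  simp only [e] at h'
  rw [← integral_indicator (hW hC), ← integral_indicator (hW hC),
    integral_cond_eq_inv_mul ((W ⁻¹' C).indicator ξ), h', mul_zero]
  simp

variable [IsProbabilityMeasure μ] {T : ℕ}

theorem integral_eq_zero_of_condDistrib {Z : Ω → 𝓩} (hZ : Measurable Z) {U : Ω → Fin T → ℝ}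
    (hU : Measurable U) {F : 𝓩 × (Fin T → ℝ) → ℝ} (hF : Measurable F)
    (h : ∀ᵐ ω ∂μ, ∫ e, F (Z ω, e) ∂(condDistrib U Z μ (Z ω)) = 0) :
    ∫ ω, F (Z ω, U ω) ∂μ = 0 := by
  by_cases hint : Integrable (fun ω => F (Z ω, U ω)) μ
  · have h1 := condExp_prod_ae_eq_integral_condDistrib hZ hU.aemeasurable hF.stronglyMeasurable hint
    rw [← integral_condExp hZ.comap_le, integral_congr_ae (h1.trans h)]
    simp
  · exact integral_undef hint

/-- Both notions of error of the model: conditionally on `Z`, the errors are centered Gaussian with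
covariance matrix `S Z`. -/
structure CondGaussianErrors (μ : Measure Ω) [IsFiniteMeasure μ] (Z : Ω → 𝓩) (ε : Fin T → Ω → ℝ)
    (S : 𝓩 → Matrix (Fin T) (Fin T) ℝ) : Prop where
  measurable_cond : Measurable Z
  measurable : ∀ t, Measurable (ε t)
  measurable_cov : ∀ t s, Measurable fun z => S z t s
  law : ∀ᵐ ω ∂μ, IsCenteredGaussian (condDistrib (fun ω t => ε t ω) Z μ (Z ω)) (S (Z ω))

variable {Z : Ω → 𝓩} {ε : Fin T → Ω → ℝ}

theorem NormalErrors.condGaussianErrors {S : Matrix (Fin T) (Fin T) ℝ}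
    (h : NormalErrors μ Z ε S) (hZ : Measurable Z) :
    CondGaussianErrors μ Z ε fun _ => S := by
  have hε : Measurable fun ω t => ε t ω := measurable_pi_lambda _ h.measurable
  refine ⟨hZ, h.measurable, fun _ _ => measurable_const, ?_⟩
  have hprob : IsProbabilityMeasure (μ.map fun ω t => ε t ω) :=
    Measure.isProbabilityMeasure_map hε.aemeasurable
  have hlaw : IsCenteredGaussian (μ.map fun ω t => ε t ω) S := by
    refine ⟨h.gaussian.isGaussian_map, fun t => ?_, fun t s => ?_⟩
    · rw [integral_map hε.aemeasurable (measurable_pi_apply t).aestronglyMeasurable]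
      exact h.mean t
    · rw [covariance_map_fun (measurable_pi_apply t).aestronglyMeasurable
        (measurable_pi_apply s).aestronglyMeasurable hε.aemeasurable]
      exact h.cov t s
  have hprod := (indepFun_iff_map_prod_eq_prod_map_map hZ.aemeasurable hε.aemeasurable).1
    h.indep.symm
  rw [← Measure.compProd_const] at hprod
  have := condDistrib_ae_eq_of_measure_eq_compProd Z hε.aemeasurable hprod
  filter_upwards [ae_of_ae_map hZ.aemeasurable this] with ω hω
  rw [hω]
  exact hlaw

theorem isCenteredGaussian_pi (w : Fin T → ℝ) (hw : ∀ t, 0 ≤ w t) :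
    IsCenteredGaussian (Measure.pi fun t => gaussianReal 0 (w t).toNNReal)
      (Matrix.diagonal w) := by
  set ν : Measure (Fin T → ℝ) := Measure.pi fun t => gaussianReal 0 (w t).toNNReal with hν
  have hind : iIndepFun (fun t (e : Fin T → ℝ) => e t) ν :=
    iIndepFun_pi (X := fun _ x => x) fun _ => aemeasurable_id
  have hlaw : ∀ t, ν.map (fun e => e t) = gaussianReal 0 (w t).toNNReal := fun t =>
    (measurePreserving_eval _ t).map_eq
  have hg : ∀ t, HasGaussianLaw (fun e : Fin T → ℝ => e t) ν := fun t =>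
    ⟨by rw [hlaw]; infer_instance⟩
  have hmean : ∀ t, ∫ e, e t ∂ν = 0 := by
    intro t
    rw [← integral_map (φ := fun e : Fin T → ℝ => e t) (f := fun x => x)
      (measurable_pi_apply t).aemeasurable (by fun_prop), hlaw, integral_id_gaussianReal]
  refine ⟨by simpa using (hind.hasGaussianLaw hg).isGaussian_map, hmean, fun t s => ?_⟩
  by_cases hts : t = s
  · subst hts
    have hvar := variance_map (X := fun x => x) (Y := fun e : Fin T → ℝ => e t) (μ := ν)
      (by fun_prop) (measurable_pi_apply t).aemeasurable
    rw [hlaw, variance_fun_id_gaussianReal, Real.coe_toNNReal _ (hw t)] at hvar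
    rw [Matrix.diagonal_apply_eq, covariance_self (measurable_pi_apply t).aemeasurable]
    exact hvar.symm
  · rw [Matrix.diagonal_apply_ne _ hts]
    exact (hind.indepFun hts).covariance_eq_zero (hg t).memLp_two (hg s).memLp_two

theorem IndividualVarianceErrors.condGaussianErrors {a : Ω → ℝ} {v : Fin T → ℝ}
    (h : IndividualVarianceErrors μ Z a v ε) (hZ : Measurable Z) :
    CondGaussianErrors μ (fun ω => (Z ω, a ω)) ε
      fun z => Matrix.diagonal fun t => z.2 + v t := by
  refine ⟨hZ.prodMk h.measurable_var, h.measurable, fun t s => ?_, ?_⟩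
  · by_cases hts : t = s
    · subst hts
      simpa using measurable_snd.add_const _
    · simp [Matrix.diagonal_apply_ne _ hts]
  · filter_upwards [h.condLaw, h.nonneg] with ω hω hpos
    rw [hω]
    exact isCenteredGaussian_pi _ hpos

theorem measurableSet_bothPos {y y' : Ω → ℝ} (hy : Measurable y) (hy' : Measurable y') :
    MeasurableSet (bothPos y y') :=
  (measurableSet_lt measurable_const hy).inter (measurableSet_lt measurable_const hy')

theorem measurableSet_allPos {y y' y'' : Ω → ℝ} (hy : Measurable y) (hy' : Measurable y')
    (hy'' : Measurable y'') : MeasurableSet (allPos y y' y'') :=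
  (measurableSet_lt measurable_const hy).inter (measurableSet_bothPos hy' hy'')

variable {S : 𝓩 → Matrix (Fin T) (Fin T) ℝ}

theorem CondGaussianErrors.setIntegral_bothPos_eq_zero (h : CondGaussianErrors μ Z ε S)
    {c c' p q g : 𝓩 → ℝ} (hc : Measurable c) (hc' : Measurable c') (hp : Measurable p)
    (hq : Measurable q) (hg : Measurable g) {t s : Fin T} (hts : t ≠ s) {k m : ℕ} (hk : 1 ≤ k)
    (hm : 1 ≤ m) {y y' ξ : Ω → ℝ} (hy : ∀ ω, y ω = c (Z ω) + ε t ω)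
    (hy' : ∀ ω, y' ω = c' (Z ω) + ε s ω)
    (hξ : ∀ ω, ξ ω = (p (Z ω) * ε t ω - q (Z ω) * ε s ω) * (y ω ^ k * y' ω ^ m)
      - (k * y ω ^ (k - 1) * y' ω ^ m * (p (Z ω) * S (Z ω) t t - q (Z ω) * S (Z ω) t s)
        + m * y ω ^ k * y' ω ^ (m - 1) * (p (Z ω) * S (Z ω) s t - q (Z ω) * S (Z ω) s s))) :
    ∫ ω in bothPos y y', g (Z ω) * ξ ω ∂μ = 0 := by
  have hε : Measurable fun ω t => ε t ω := measurable_pi_lambda _ h.measurable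
  have hZ := h.measurable_cond
  have hA : MeasurableSet (bothPos y y') := by
    have e1 : y = fun ω => c (Z ω) + ε t ω := funext hy
    have e2 : y' = fun ω => c' (Z ω) + ε s ω := funext hy'
    rw [e1, e2]
    exact measurableSet_bothPos ((hc.comp hZ).add (h.measurable t))
      ((hc'.comp hZ).add (h.measurable s))
  have hS := h.measurable_cov
  let F : 𝓩 × (Fin T → ℝ) → ℝ := fun x => g x.1 *
    {x : 𝓩 × (Fin T → ℝ) | 0 < c x.1 + x.2 t ∧ 0 < c' x.1 + x.2 s}.indicator
      (fun x => (p x.1 * x.2 t - q x.1 * x.2 s) * ((c x.1 + x.2 t) ^ k * (c' x.1 + x.2 s) ^ m)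
        - (k * (c x.1 + x.2 t) ^ (k - 1) * (c' x.1 + x.2 s) ^ m
            * (p x.1 * S x.1 t t - q x.1 * S x.1 t s)
          + m * (c x.1 + x.2 t) ^ k * (c' x.1 + x.2 s) ^ (m - 1)
            * (p x.1 * S x.1 s t - q x.1 * S x.1 s s))) x
  have hF : Measurable F := by
    refine (by fun_prop : Measurable fun x : 𝓩 × (Fin T → ℝ) => g x.1).mul
      (Measurable.indicator (by fun_prop) ?_)
    exact measurableSet_bothPos (y := fun x : 𝓩 × (Fin T → ℝ) => c x.1 + x.2 t)
      (y' := fun x : 𝓩 × (Fin T → ℝ) => c' x.1 + x.2 s) (by fun_prop) (by fun_prop)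
  rw [← integral_indicator hA]
  have hFξ : ∀ ω, (bothPos y y').indicator (fun ω => g (Z ω) * ξ ω) ω
      = F (Z ω, fun t => ε t ω) := by
    intro ω
    by_cases hω : ω ∈ bothPos y y'
    · have hω' : 0 < c (Z ω) + ε t ω ∧ 0 < c' (Z ω) + ε s ω := by
        rw [← hy, ← hy']; exact hω
      rw [Set.indicator_of_mem hω]
      simp only [F]
      rw [Set.indicator_of_mem (by exact hω'), hξ, hy, hy']
    · have hω' : ¬ (0 < c (Z ω) + ε t ω ∧ 0 < c' (Z ω) + ε s ω) := by
        rw [← hy, ← hy']; exact hω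
      rw [Set.indicator_of_notMem hω]
      simp only [F]
      rw [Set.indicator_of_notMem (by exact hω'), mul_zero]
  simp only [hFξ]
  refine integral_eq_zero_of_condDistrib hZ hε hF ?_
  filter_upwards [h.law] with ω hω
  simp only [F]
  rw [integral_const_mul]
  have key := hω.integral_eq_zero t s (p (Z ω)) (q (Z ω))
    (fun i => if i = t then c (Z ω) else c' (Z ω)) ∅ (by simp) hk hm
  simp only [if_true, if_neg hts.symm, Finset.notMem_empty, false_imp_iff, implies_true,
    and_true] at key
  exact (congrArg (g (Z ω) * ·) key).trans (mul_zero _)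

theorem CondGaussianErrors.condMeanZero_bothPos (h : CondGaussianErrors μ Z ε S)
    {c c' p q g : 𝓩 → ℝ} (hc : Measurable c) (hc' : Measurable c') (hp : Measurable p)
    (hq : Measurable q) (hg : Measurable g) {t s : Fin T} (hts : t ≠ s) {k m : ℕ} (hk : 1 ≤ k)
    (hm : 1 ≤ m) {y y' ξ : Ω → ℝ} (hy : ∀ ω, y ω = c (Z ω) + ε t ω)
    (hy' : ∀ ω, y' ω = c' (Z ω) + ε s ω)
    (hξ : ∀ ω, ξ ω = g (Z ω) * ((p (Z ω) * ε t ω - q (Z ω) * ε s ω) * (y ω ^ k * y' ω ^ m)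
      - (k * y ω ^ (k - 1) * y' ω ^ m * (p (Z ω) * S (Z ω) t t - q (Z ω) * S (Z ω) t s)
        + m * y ω ^ k * y' ω ^ (m - 1) * (p (Z ω) * S (Z ω) s t - q (Z ω) * S (Z ω) s s))))
    {φ : 𝓩 → 𝓦} (hφ : Measurable φ) (hint : Integrable ξ (μ[|bothPos y y'])) :
    CondMeanZero μ (bothPos y y') (fun ω => φ (Z ω)) ξ := by
  refine condMeanZero_of_forall_setIntegral_eq_zero (hφ.comp h.measurable_cond) hint
    fun C hC => ?_
  have := h.setIntegral_bothPos_eq_zero hc hc' hp hq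
    (((measurable_one.indicator hC).comp hφ).mul hg) hts hk hm hy hy' (fun _ => rfl)
  rw [← this]
  refine integral_congr_ae (ae_of_all _ fun ω => ?_)
  simp only [hξ, Pi.mul_apply, Function.comp]
  ring

end Disintegration

end PanelTobit

namespace PanelTobit

/-- The contribution of one pair of periods to the residual of the three-period equation. -/
def pairTerm (e e' y y' a a' : ℝ) : ℝ := (e - e') * (y * y') - (y' * a - y * a')

theorem integrable_mul_mul {α : Type*} [MeasurableSpace α] {ν : Measure α} {f g h : α → ℝ}
    (hf : MemLp f 2 ν) (hg : MemLp g 4 ν) (hh : MemLp h 4 ν) :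
    Integrable (fun x => f x * (g x * h x)) ν := by
  have : ENNReal.HolderTriple 4 4 2 := ⟨by
    rw [← two_mul, show (4 : ENNReal) = 2 * 2 by norm_num,
      ENNReal.mul_inv (by simp) (by simp), ← mul_assoc, ENNReal.mul_inv_cancel (by simp) (by simp),
      one_mul]⟩
  have hgh : MemLp (fun x => g x * h x) 2 ν := hh.mul' hg
  exact hf.integrable_mul hgh

variable {T : ℕ}

theorem IsCenteredGaussian.integrable_pairTerm {ν : Measure (Fin T → ℝ)}
    {S : Matrix (Fin T) (Fin T) ℝ} (h : IsCenteredGaussian ν S) (c w : Fin T → ℝ) (t s : Fin T) :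
    Integrable (fun e => pairTerm (e t) (e s) (c t + e t) (c s + e s) (w t) (w s)) ν := by
  have := h.gaussian
  have hL : ∀ i {r : ENNReal}, r ≠ ⊤ → MemLp (fun e : Fin T → ℝ => c i + e i) r ν := fun i r hr =>
    (memLp_const (c i)).add (h.memLp_eval i hr)
  have hI : ∀ i, Integrable (fun e : Fin T → ℝ => c i + e i) ν := fun i =>
    memLp_one_iff_integrable.1 (hL i (by simp))
  exact (integrable_mul_mul ((h.memLp_eval t (by simp)).sub (h.memLp_eval s (by simp)))
    (hL t (by simp)) (hL s (by simp))).sub (((hI s).mul_const _).sub ((hI t).mul_const _))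

theorem IsCenteredGaussian.integral_pairTerm {ν : Measure (Fin T → ℝ)} {w : Fin T → ℝ}
    (h : IsCenteredGaussian ν (Matrix.diagonal w)) (c : Fin T → ℝ) {t s τ : Fin T}
    (hts : t ≠ s) (hsτ : s ≠ τ) (htτ : t ≠ τ) {A : Set (Fin T → ℝ)}
    (hA : ∀ e, e ∈ A ↔ (0 < c t + e t ∧ 0 < c s + e s) ∧ 0 < c τ + e τ) :
    ∫ e, A.indicator
      (fun e => pairTerm (e t) (e s) (c t + e t) (c s + e s) (w t) (w s)) e ∂ν = 0 := by
  have key := h.integral_eq_zero t s 1 1 c {τ}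
    (by simp [Matrix.diagonal_apply_ne _ hsτ.symm, Matrix.diagonal_apply_ne _ htτ.symm])
    le_rfl le_rfl
  rw [← key]
  refine integral_congr_ae (ae_of_all _ fun e => ?_)
  simp only [Set.indicator, Set.mem_ofPred_eq, hA, Finset.mem_singleton, forall_eq]
  refine if_congr Iff.rfl ?_ rfl
  simp only [pairTerm, Matrix.diagonal_apply_eq, Matrix.diagonal_apply_ne _ hts,
    Matrix.diagonal_apply_ne _ hts.symm, Nat.cast_one, Nat.sub_self, pow_zero, pow_one]
  ring

variable {Ω 𝓩 𝓦 : Type*} [MeasurableSpace Ω] [MeasurableSpace 𝓩] [MeasurableSpace 𝓦]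
  {μ : Measure Ω} [IsProbabilityMeasure μ] {Z : Ω → 𝓩} {ε : Fin T → Ω → ℝ}

theorem CondGaussianErrors.condMeanZero_allPos {w : 𝓩 → Fin T → ℝ}
    (h : CondGaussianErrors μ Z ε fun z => Matrix.diagonal (w z)) (hw : Measurable w)
    {c : 𝓩 → Fin T → ℝ} (hc : Measurable c) {t s τ : Fin T}
    (hts : t ≠ s) (hsτ : s ≠ τ) (htτ : t ≠ τ) {y : Fin T → Ω → ℝ} {ξ : Ω → ℝ}
    (hy : ∀ i ω, y i ω = c (Z ω) i + ε i ω)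
    (hξ : ∀ ω, ξ ω
      = pairTerm (ε t ω) (ε s ω) (y t ω) (y s ω) (w (Z ω) t) (w (Z ω) s)
        + pairTerm (ε s ω) (ε τ ω) (y s ω) (y τ ω) (w (Z ω) s) (w (Z ω) τ)
        + pairTerm (ε τ ω) (ε t ω) (y τ ω) (y t ω) (w (Z ω) τ) (w (Z ω) t))
    {φ : 𝓩 → 𝓦} (hφ : Measurable φ) (hint : Integrable ξ (μ[|allPos (y t) (y s) (y τ)])) :
    CondMeanZero μ (allPos (y t) (y s) (y τ)) (fun ω => φ (Z ω)) ξ := by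
  have hε : Measurable fun ω t => ε t ω := measurable_pi_lambda _ h.measurable
  have hZ := h.measurable_cond
  have hym : ∀ i, Measurable (y i) := fun i => by
    rw [show y i = fun ω => c (Z ω) i + ε i ω from funext (hy i)]
    exact (measurable_pi_iff.1 (hc.comp hZ) i).add (h.measurable i)
  refine condMeanZero_of_forall_setIntegral_eq_zero (hφ.comp hZ) hint fun C hC => ?_
  let A : 𝓩 → Set (Fin T → ℝ) := fun z => {e | 0 < c z t + e t ∧ 0 < c z s + e s ∧ 0 < c z τ + e τ}
  let G : Fin T → Fin T → 𝓩 → (Fin T → ℝ) → ℝ := fun i j z e =>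
    pairTerm (e i) (e j) (c z i + e i) (c z j + e j) (w z i) (w z j)
  let F : 𝓩 × (Fin T → ℝ) → ℝ := fun x => C.indicator 1 (φ x.1) *
    {x : 𝓩 × (Fin T → ℝ) | x.2 ∈ A x.1}.indicator
      (fun x => G t s x.1 x.2 + G s τ x.1 x.2 + G τ t x.1 x.2) x
  have hF : Measurable F := by
    refine (((measurable_one.indicator hC).comp hφ).comp measurable_fst).mul
      (Measurable.indicator ?_ ?_)
    · simp only [G, pairTerm]
      fun_prop
    · exact measurableSet_allPos (y := fun x : 𝓩 × (Fin T → ℝ) => c x.1 t + x.2 t)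
        (y' := fun x => c x.1 s + x.2 s) (y'' := fun x => c x.1 τ + x.2 τ)
        (by fun_prop) (by fun_prop) (by fun_prop)
  rw [← integral_indicator (measurableSet_allPos (hym t) (hym s) (hym τ))]
  have hFξ : ∀ ω, (allPos (y t) (y s) (y τ)).indicator
      (fun ω => C.indicator 1 (φ (Z ω)) * ξ ω) ω = F (Z ω, fun t => ε t ω) := by
    intro ω
    have hmem : ω ∈ allPos (y t) (y s) (y τ) ↔ (fun t => ε t ω) ∈ A (Z ω) := by
      simp only [allPos, A, Set.mem_ofPred_eq, hy]
    by_cases hω : ω ∈ allPos (y t) (y s) (y τ)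
    · have hω' := hmem.1 hω
      rw [Set.indicator_of_mem hω, hξ]
      simp only [F, G, Set.indicator, Set.mem_ofPred_eq, if_pos hω', hy]
    · have hω' := fun h' => hω (hmem.2 h')
      rw [Set.indicator_of_notMem hω]
      simp only [F, Set.indicator, Set.mem_ofPred_eq, if_neg hω', mul_zero]
  change ∫ ω, (allPos (y t) (y s) (y τ)).indicator
      (fun ω => C.indicator 1 (φ (Z ω)) * ξ ω) ω ∂μ = 0
  simp only [hFξ]
  refine integral_eq_zero_of_condDistrib hZ hε hF ?_
  filter_upwards [h.law] with ω hω
  have hA : MeasurableSet (A (Z ω)) :=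
    measurableSet_allPos (y := fun e : Fin T → ℝ => c (Z ω) t + e t)
      (y' := fun e => c (Z ω) s + e s) (y'' := fun e => c (Z ω) τ + e τ)
      (measurable_const.add (measurable_pi_apply t)) (measurable_const.add (measurable_pi_apply s))
      (measurable_const.add (measurable_pi_apply τ))
  have hint' : ∀ i j, Integrable (fun e => (A (Z ω)).indicator (G i j (Z ω)) e)
      (condDistrib (fun ω t => ε t ω) Z μ (Z ω)) := fun i j =>
    (hω.integrable_pairTerm (c (Z ω)) (w (Z ω)) i j).indicator hA
  have hzero : ∀ i j l, i ≠ j → j ≠ l → i ≠ l → (∀ e, e ∈ A (Z ω) ↔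
      (0 < c (Z ω) i + e i ∧ 0 < c (Z ω) j + e j) ∧ 0 < c (Z ω) l + e l) →
      ∫ e, (A (Z ω)).indicator (G i j (Z ω)) e ∂(condDistrib (fun ω t => ε t ω) Z μ (Z ω)) = 0 :=
    fun i j l hij hjl hil => hω.integral_pairTerm (c (Z ω)) hij hjl hil
  have hsum : ∀ e, F (Z ω, e) = C.indicator 1 (φ (Z ω)) *
      ((A (Z ω)).indicator (G t s (Z ω)) e + (A (Z ω)).indicator (G s τ (Z ω)) e
        + (A (Z ω)).indicator (G τ t (Z ω)) e) := by
    intro e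
    by_cases he : e ∈ A (Z ω)
    · simp [F, Set.indicator, he]
    · simp [F, Set.indicator, he]
  simp only [hsum]
  have h12 : Integrable (fun e => (A (Z ω)).indicator (G t s (Z ω)) e
      + (A (Z ω)).indicator (G s τ (Z ω)) e) (condDistrib (fun ω t => ε t ω) Z μ (Z ω)) :=
    (hint' t s).add (hint' s τ)
  rw [integral_const_mul, integral_add h12 (hint' τ t), integral_add (hint' t s) (hint' s τ),
    hzero t s τ hts hsτ htτ, hzero s τ t hsτ htτ.symm hts.symm,
    hzero τ t s htτ.symm hts hsτ.symm]
  · simp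
  all_goals
    intro e
    simp only [A, Set.mem_ofPred_eq]
    tauto

end PanelTobit

namespace PanelTobit

theorem measurable_dotProduct_const {α ι : Type*} [MeasurableSpace α] [Fintype ι] {f : α → ι → ℝ}
    (hf : Measurable f) (b : ι → ℝ) : Measurable fun x => f x ⬝ᵥ b := by
  simp only [dotProduct]
  fun_prop

variable {Ω 𝓩 : Type*} [MeasurableSpace Ω] [MeasurableSpace 𝓩] {μ : Measure Ω}
  [IsProbabilityMeasure μ] {T d : ℕ}

omit [IsProbabilityMeasure μ] in
theorem NormalErrors.cov_comm {Z : Ω → 𝓩} {ε : Fin T → Ω → ℝ} {S : Matrix (Fin T) (Fin T) ℝ}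
    (h : NormalErrors μ Z ε S) (t s : Fin T) : S t s = S s t := by
  rw [← h.cov, ← h.cov, covariance_comm]

variable {β : Fin d → ℝ} {x : Fin T → Ω → Fin d → ℝ} {α : Ω → ℝ} {ε : Fin T → Ω → ℝ}
  {S : Matrix (Fin T) (Fin T) ℝ} {yl : Fin T → Ω → ℝ}

/-- The systematic part `x_t'β + α` of the latent outcome. -/
def systematic (β : Fin d → ℝ) (t : Fin T) (z : ℝ × (Fin T → Fin d → ℝ)) : ℝ := z.2 t ⬝ᵥ β + z.1

theorem measurable_systematic (β : Fin d → ℝ) (t : Fin T) :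
    Measurable (systematic β t : ℝ × (Fin T → Fin d → ℝ) → ℝ) :=
  (measurable_dotProduct_const (by fun_prop) β).add measurable_fst

theorem NormalErrors.setIntegral_mul_residual_eq_zero (hx : ∀ t, Measurable (x t))
    (hα : Measurable α) (hyl : ∀ t, yl t = latent β (x t) α (ε t))
    (h : NormalErrors μ (fun ω => (α ω, fun t => x t ω)) ε S) {t s : Fin T} (hts : t ≠ s)
    {k m : ℕ} (hk : 1 ≤ k) (hm : 1 ≤ m) {g : (Fin d → ℝ) × (Fin d → ℝ) → ℝ} (hg : Measurable g) :
    ∫ ω in bothPos (yl t) (yl s), g (x t ω, x s ω) * residual k m (yl t ω) (yl s ω)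
      ((x t ω - x s ω) ⬝ᵥ β) (S t t - S t s) (S s s - S t s) ∂μ = 0 := by
  have hZ : Measurable fun ω => (α ω, fun t => x t ω) := hα.prodMk (measurable_pi_lambda _ hx)
  refine (h.condGaussianErrors hZ).setIntegral_bothPos_eq_zero (measurable_systematic β t)
    (measurable_systematic β s) measurable_const measurable_const (p := fun _ => 1) (q := fun _ => 1)
    (g := fun z => g (z.2 t, z.2 s)) (by fun_prop) hts hk hm
    (fun ω => by simp [hyl, latent, systematic])
    (fun ω => by simp [hyl, latent, systematic]) fun ω => ?_
  have e1 : ε t ω = yl t ω - x t ω ⬝ᵥ β - α ω := by simp [hyl, latent]; ring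
  have e2 : ε s ω = yl s ω - x s ω ⬝ᵥ β - α ω := by simp [hyl, latent]; ring
  rw [e1, e2, residual, sub_dotProduct, h.cov_comm s t]
  ring

theorem NormalErrors.condMeanZero_residual (hx : ∀ t, Measurable (x t)) (hα : Measurable α)
    (hyl : ∀ t, yl t = latent β (x t) α (ε t))
    (h : NormalErrors μ (fun ω => (α ω, fun t => x t ω)) ε S) {t s : Fin T} (hts : t ≠ s)
    {k m : ℕ} (hk : 1 ≤ k) (hm : 1 ≤ m) {ξ : Ω → ℝ}
    (hξ : ∀ ω, ξ ω = residual k m (yl t ω) (yl s ω) ((x t ω - x s ω) ⬝ᵥ β)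
      (S t t - S t s) (S s s - S t s))
    (hint : Integrable ξ (μ[|bothPos (yl t) (yl s)])) :
    CondMeanZero μ (bothPos (yl t) (yl s)) (fun ω => (x t ω, x s ω)) ξ := by
  refine condMeanZero_of_forall_setIntegral_eq_zero ((hx t).prodMk (hx s)) hint fun C hC => ?_
  simp only [hξ]
  exact h.setIntegral_mul_residual_eq_zero hx hα hyl hts hk hm (measurable_one.indicator hC)

theorem NormalErrors.condMeanZero_loadingResidual {ρ : Fin T → ℝ} (hx : ∀ t, Measurable (x t))
    (hα : Measurable α) (hyl : ∀ t, yl t = latent β (x t) (fun ω => ρ t * α ω) (ε t))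
    (h : NormalErrors μ (fun ω => (α ω, fun t => x t ω)) ε S) {t s : Fin T} (hts : t ≠ s)
    (hρ : ρ s ≠ 0) {k m : ℕ} (hk : 1 ≤ k) (hm : 1 ≤ m) {ξ : Ω → ℝ}
    (hξ : ∀ ω, ξ ω = loadingResidual k m (ρ t / ρ s) (yl t ω) (yl s ω)
      ((x t ω - (ρ t / ρ s) • x s ω) ⬝ᵥ β)
      (S t t - S t s * (ρ t / ρ s)) (S s s * (ρ t / ρ s) - S t s))
    (hint : Integrable ξ (μ[|bothPos (yl t) (yl s)])) :
    CondMeanZero μ (bothPos (yl t) (yl s)) (fun ω => (x t ω, x s ω)) ξ := by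
  have hZ : Measurable fun ω => (α ω, fun t => x t ω) := hα.prodMk (measurable_pi_lambda _ hx)
  have hc : ∀ t, Measurable fun z : ℝ × (Fin T → Fin d → ℝ) => z.2 t ⬝ᵥ β + ρ t * z.1 := fun t =>
    (measurable_dotProduct_const (by fun_prop) β).add (by fun_prop)
  refine (h.condGaussianErrors hZ).condMeanZero_bothPos (hc t) (hc s) (p := fun _ => 1)
    (q := fun _ => ρ t / ρ s) (g := fun _ => 1) (φ := fun z => (z.2 t, z.2 s)) measurable_const
    measurable_const measurable_const hts hk hm (fun ω => by simp [hyl, latent])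
    (fun ω => by simp [hyl, latent]) (fun ω => ?_) (by fun_prop) hint
  obtain ⟨k, rfl⟩ := Nat.exists_eq_add_of_le' hk
  obtain ⟨m, rfl⟩ := Nat.exists_eq_add_of_le' hm
  have e1 : ε t ω = yl t ω - x t ω ⬝ᵥ β - (ρ t / ρ s) * (ρ s * α ω) := by
    rw [← mul_assoc, div_mul_cancel₀ _ hρ]; simp [hyl, latent]; ring
  have e2 : ε s ω = yl s ω - x s ω ⬝ᵥ β - ρ s * α ω := by simp [hyl, latent]; ring
  rw [hξ, e1, e2, loadingResidual, sub_dotProduct, smul_dotProduct, h.cov_comm s t, smul_eq_mul]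
  ring

theorem NormalErrors.condMeanZero_slopeResidual {z : Fin T → Ω → ℝ} (hx : ∀ t, Measurable (x t))
    (hα : Measurable α) (hz : ∀ t, Measurable (z t))
    (hyl : ∀ t, yl t = latent β (x t) (fun ω => z t ω * α ω) (ε t))
    (h : NormalErrors μ (fun ω => (α ω, (fun t => x t ω), fun t => z t ω)) ε S) {t s : Fin T}
    (hts : t ≠ s) {k m : ℕ} (hk : 1 ≤ k) (hm : 1 ≤ m) {ξ : Ω → ℝ}
    (hξ : ∀ ω, ξ ω = residual k m (yl t ω * z s ω) (yl s ω * z t ω)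
      ((z s ω • x t ω - z t ω • x s ω) ⬝ᵥ β)
      (z s ω ^ 2 * S t t - z t ω * z s ω * S t s)
      (z t ω ^ 2 * S s s - z t ω * z s ω * S t s))
    (hint : Integrable ξ (μ[|bothPos (yl t) (yl s)])) :
    CondMeanZero μ (bothPos (yl t) (yl s)) (fun ω => (z t ω, z s ω, x t ω, x s ω)) ξ := by
  have hZ : Measurable fun ω => (α ω, (fun t => x t ω), fun t => z t ω) :=
    hα.prodMk ((measurable_pi_lambda _ hx).prodMk (measurable_pi_lambda _ hz))
  have hc : ∀ t, Measurable fun w : ℝ × (Fin T → Fin d → ℝ) × (Fin T → ℝ) =>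
      w.2.1 t ⬝ᵥ β + w.2.2 t * w.1 := fun t =>
    (measurable_dotProduct_const (by fun_prop) β).add (by fun_prop)
  refine (h.condGaussianErrors hZ).condMeanZero_bothPos (hc t) (hc s) (p := fun w => w.2.2 s)
    (q := fun w => w.2.2 t) (g := fun w => w.2.2 s ^ k * w.2.2 t ^ m)
    (φ := fun w => (w.2.2 t, w.2.2 s, w.2.1 t, w.2.1 s)) (by fun_prop)
    (by fun_prop) (by fun_prop) hts hk hm (fun ω => by simp [hyl, latent])
    (fun ω => by simp [hyl, latent]) (fun ω => ?_) (by fun_prop) hint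
  obtain ⟨k, rfl⟩ := Nat.exists_eq_add_of_le' hk
  obtain ⟨m, rfl⟩ := Nat.exists_eq_add_of_le' hm
  have e1 : ε t ω = yl t ω - x t ω ⬝ᵥ β - z t ω * α ω := by simp [hyl, latent]; ring
  have e2 : ε s ω = yl s ω - x s ω ⬝ᵥ β - z s ω * α ω := by simp [hyl, latent]; ring
  rw [hξ, e1, e2, residual, sub_dotProduct, smul_dotProduct, smul_dotProduct, h.cov_comm s t,
    smul_eq_mul, smul_eq_mul]
  simp only [Nat.add_sub_cancel]
  ring

theorem IndividualVarianceErrors.condMeanZero_residual {a : Ω → ℝ} {v : Fin T → ℝ}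
    (hx : ∀ t, Measurable (x t)) (hα : Measurable α) (hyl : ∀ t, yl t = latent β (x t) α (ε t))
    (h : IndividualVarianceErrors μ (fun ω => (α ω, fun t => x t ω)) a v ε) {t s : Fin T}
    (hts : t ≠ s) {k m : ℕ} (hk : 1 ≤ k) (hm : 1 ≤ m) {ξ : Ω → ℝ}
    (hξ : ∀ ω, ξ ω = residual k m (yl t ω) (yl s ω) ((x t ω - x s ω) ⬝ᵥ β) (a ω + v t) (a ω + v s))
    (hint : Integrable ξ (μ[|bothPos (yl t) (yl s)])) :
    CondMeanZero μ (bothPos (yl t) (yl s)) (fun ω => (x t ω, x s ω)) ξ := by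
  have hZ : Measurable fun ω => (α ω, fun t => x t ω) := hα.prodMk (measurable_pi_lambda _ hx)
  refine (h.condGaussianErrors hZ).condMeanZero_bothPos
    ((measurable_systematic β t).comp measurable_fst)
    ((measurable_systematic β s).comp measurable_fst) (p := fun _ => 1)
    (q := fun _ => 1) (g := fun _ => 1) (φ := fun z => (z.1.2 t, z.1.2 s)) measurable_const
    measurable_const measurable_const hts hk hm (fun ω => by simp [hyl, latent, systematic])
    (fun ω => by simp [hyl, latent, systematic]) (fun ω => ?_) (by fun_prop) hint
  have e1 : ε t ω = yl t ω - x t ω ⬝ᵥ β - α ω := by simp [hyl, latent]; ring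
  have e2 : ε s ω = yl s ω - x s ω ⬝ᵥ β - α ω := by simp [hyl, latent]; ring
  rw [hξ, e1, e2, residual, sub_dotProduct, Matrix.diagonal_apply_eq, Matrix.diagonal_apply_eq,
    Matrix.diagonal_apply_ne _ hts, Matrix.diagonal_apply_ne _ hts.symm]
  ring

theorem IndividualVarianceErrors.condMeanZero_triple {a : Ω → ℝ} {v : Fin T → ℝ}
    (hx : ∀ t, Measurable (x t)) (hα : Measurable α) (hyl : ∀ t, yl t = latent β (x t) α (ε t))
    (h : IndividualVarianceErrors μ (fun ω => (α ω, fun t => x t ω)) a v ε) {t s τ : Fin T}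
    (hts : t ≠ s) (hsτ : s ≠ τ) (htτ : t ≠ τ) {ξ : Ω → ℝ}
    (hξ : ∀ ω, ξ ω = tripleLhs (yl t ω) (yl s ω) (yl τ ω)
      - (tripleReg β (yl t ω) (yl s ω) (yl τ ω) (x t ω) (x s ω) (x τ ω)
        + (yl τ ω - yl t ω) * v s + (yl s ω - yl τ ω) * v t + (yl t ω - yl s ω) * v τ))
    (hint : Integrable ξ (μ[|allPos (yl t) (yl s) (yl τ)])) :
    CondMeanZero μ (allPos (yl t) (yl s) (yl τ)) (fun ω => (x t ω, x s ω, x τ ω)) ξ := by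
  have hZ : Measurable fun ω => (α ω, fun t => x t ω) := hα.prodMk (measurable_pi_lambda _ hx)
  refine (h.condGaussianErrors hZ).condMeanZero_allPos
    (measurable_pi_lambda _ fun t => by fun_prop)
    (c := fun z t => systematic β t z.1)
    (measurable_pi_lambda _ fun t => (measurable_systematic β t).comp measurable_fst)
    hts hsτ htτ (fun i ω => by simp [hyl, latent, systematic]) (fun ω => ?_)
    (φ := fun z => (z.1.2 t, z.1.2 s, z.1.2 τ)) (by fun_prop) hint
  have e : ∀ t, ε t ω = yl t ω - x t ω ⬝ᵥ β - α ω := fun t => by simp [hyl, latent]; ring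
  rw [hξ, e, e, e]
  simp only [tripleLhs, tripleReg, pairTerm, add_dotProduct, smul_dotProduct, sub_dotProduct,
    smul_eq_mul]
  ring

end PanelTobit

namespace PanelTobit

section LinearAlgebra

theorem mulVec_injective_of_rank_eq_card {Q P : Type*} [Fintype P] {M : Matrix Q P ℝ} (h : M.rank = Fintype.card P) :
    Function.Injective M.mulVec := by
  have h1 := M.mulVecLin.finrank_range_add_finrank_ker
  rw [Module.finrank_fintype_fun_eq_card] at h1
  have h2 : Module.finrank ℝ (LinearMap.ker M.mulVecLin) = 0 := by
    have h3 : Module.finrank ℝ (LinearMap.range M.mulVecLin) = Fintype.card P := h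
    omega
  have h4 := LinearMap.ker_eq_bot.1 (Submodule.finrank_eq_zero.1 h2)
  exact h4

theorem tendsto_matrix_mul {ι R C K : Type*} [Fintype C] {l : Filter ι} {M : ι → Matrix R C ℝ}
    {N : ι → Matrix C K ℝ} {M₀ : Matrix R C ℝ} {N₀ : Matrix C K ℝ} (hM : Tendsto M l (𝓝 M₀))
    (hN : Tendsto N l (𝓝 N₀)) : Tendsto (fun i => M i * N i) l (𝓝 (M₀ * N₀)) :=
  ((continuous_fst.matrix_mul continuous_snd).tendsto (_, _)).comp (hM.prodMk_nhds hN)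

theorem tendsto_matrix_mulVec {ι R C : Type*} [Fintype C] {l : Filter ι} {M : ι → Matrix R C ℝ}
    {N : ι → C → ℝ} {M₀ : Matrix R C ℝ} {N₀ : C → ℝ} (hM : Tendsto M l (𝓝 M₀))
    (hN : Tendsto N l (𝓝 N₀)) : Tendsto (fun i => M i *ᵥ N i) l (𝓝 (M₀ *ᵥ N₀)) :=
  ((continuous_fst.matrix_mulVec continuous_snd).tendsto (_, _)).comp (hM.prodMk_nhds hN)

variable {Q P : Type*} [Fintype Q] [DecidableEq Q] [Fintype P] [DecidableEq P]

/-- Two-stage least squares as a function of the moments `Σ w w'`, `Σ w r'`, `Σ y w`. -/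
noncomputable def twoStage (A : Matrix Q Q ℝ) (B : Matrix Q P ℝ) (c : Q → ℝ) : P → ℝ :=
  (Bᵀ * A⁻¹ * B)⁻¹ *ᵥ ((Bᵀ * A⁻¹) *ᵥ c)

theorem inv_smul_matrix {k : ℝ} (hk : k ≠ 0) (A : Matrix Q Q ℝ) : (k • A)⁻¹ = k⁻¹ • A⁻¹ := by
  by_cases hA : IsUnit A.det
  · exact Matrix.inv_smul' A (Units.mk0 k hk) hA
  · have hkA : ¬ IsUnit (k • A).det := by
      rw [Matrix.det_smul, IsUnit.mul_iff]
      exact fun h => hA h.2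
    rw [Matrix.nonsing_inv_apply_not_isUnit _ hA, Matrix.nonsing_inv_apply_not_isUnit _ hkA,
      smul_zero]

theorem twoStage_smul {k : ℝ} (hk : k ≠ 0) (A : Matrix Q Q ℝ) (B : Matrix Q P ℝ) (c : Q → ℝ) :
    twoStage (k • A) (k • B) (k • c) = twoStage A B c := by
  have h1 : (k • B)ᵀ * (k • A)⁻¹ = Bᵀ * A⁻¹ := by
    rw [inv_smul_matrix hk, Matrix.transpose_smul, Matrix.smul_mul, Matrix.mul_smul, smul_smul,
      mul_inv_cancel₀ hk, one_smul]
  rw [twoStage, twoStage, h1, Matrix.mul_smul, inv_smul_matrix hk, Matrix.mulVec_smul,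
    Matrix.smul_mulVec, Matrix.mulVec_smul, smul_smul, inv_mul_cancel₀ hk, one_smul]

theorem tendsto_matrix_inv {ι : Type*} {l : Filter ι} {A : ι → Matrix Q Q ℝ} {A₀ : Matrix Q Q ℝ}
    (hA : Tendsto A l (𝓝 A₀)) (hdet : A₀.det ≠ 0) : Tendsto (fun i => (A i)⁻¹) l (𝓝 A₀⁻¹) := by
  simp only [Matrix.inv_def, Ring.inverse_eq_inv']
  exact (((continuous_id.matrix_det.tendsto A₀).comp hA).inv₀ hdet).smul
    ((continuous_id.matrix_adjugate.tendsto A₀).comp hA)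

theorem det_transpose_mul_inv_mul_ne_zero {A : Matrix Q Q ℝ} (hA : A.PosSemidef)
    (hdet : A.det ≠ 0) {B : Matrix Q P ℝ} (hB : Function.Injective B.mulVec) :
    (Bᵀ * A⁻¹ * B).det ≠ 0 := by
  have h := (hA.posDef_iff_det_ne_zero.2 hdet).inv.conjTranspose_mul_mul_same hB
  rw [Matrix.conjTranspose_eq_transpose_of_trivial] at h
  exact h.det_pos.ne'

theorem twoStage_mulVec {A : Matrix Q Q ℝ} {B : Matrix Q P ℝ}
    (hdet : (Bᵀ * A⁻¹ * B).det ≠ 0) (θ : P → ℝ) : twoStage A B (B *ᵥ θ) = θ := by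
  rw [twoStage, Matrix.mulVec_mulVec, Matrix.mulVec_mulVec, Matrix.mul_assoc _ (_ * _) B,
    Matrix.nonsing_inv_mul _ (isUnit_iff_ne_zero.2 hdet), Matrix.one_mulVec]

theorem tendsto_twoStage {ι : Type*} {l : Filter ι} {A : ι → Matrix Q Q ℝ} {B : ι → Matrix Q P ℝ}
    {c : ι → Q → ℝ} {A₀ : Matrix Q Q ℝ} {B₀ : Matrix Q P ℝ} {θ : P → ℝ}
    (hA : Tendsto A l (𝓝 A₀)) (hB : Tendsto B l (𝓝 B₀)) (hc : Tendsto c l (𝓝 (B₀ *ᵥ θ)))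
    (hpsd : A₀.PosSemidef) (hdet : A₀.det ≠ 0) (hinj : Function.Injective B₀.mulVec) :
    Tendsto (fun i => twoStage (A i) (B i) (c i)) l (𝓝 θ) := by
  have hd := det_transpose_mul_inv_mul_ne_zero hpsd hdet hinj
  have hBT : Tendsto (fun i => (B i)ᵀ) l (𝓝 B₀ᵀ) :=
    (continuous_id.matrix_transpose.tendsto B₀).comp hB
  have h1 := tendsto_matrix_mul hBT (tendsto_matrix_inv hA hdet)
  have h2 := tendsto_matrix_mulVec (tendsto_matrix_inv (tendsto_matrix_mul h1 hB) hd)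
    (tendsto_matrix_mulVec h1 hc)
  rw [← twoStage_mulVec hd θ]
  exact h2

end LinearAlgebra

variable {Ω : Type*} [MeasurableSpace Ω] {μ : Measure Ω}

theorem posSemidef_condMoment {Q : Type*} [Fintype Q] {A : Set Ω} {w : Ω → Q → ℝ}
    (hint : ∀ j l, Integrable (fun ω => w ω j * w ω l) (μ[|A])) :
    (condMoment μ A w w).PosSemidef := by
  refine Matrix.PosSemidef.of_dotProduct_mulVec_nonneg ?_ fun x => ?_
  · ext j l
    simp [condMoment, mul_comm]
  · have : star x ⬝ᵥ (condMoment μ A w w *ᵥ x) = ∫ ω, (w ω ⬝ᵥ x) ^ 2 ∂(μ[|A]) := by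
      have e : ∀ ω, (w ω ⬝ᵥ x) ^ 2 = ∑ j, ∑ l, x j * (w ω j * w ω l * x l) := by
        intro ω
        rw [sq, dotProduct, Finset.sum_mul_sum]
        exact Finset.sum_congr rfl fun j _ => Finset.sum_congr rfl fun l _ => by ring
      simp only [e]
      rw [integral_finsetSum _ fun j _ => integrable_finsetSum _ fun l _ =>
        ((hint j l).mul_const _).const_mul _]
      simp only [dotProduct, Matrix.mulVec, condMoment, Matrix.of_apply, star_trivial]
      refine Finset.sum_congr rfl fun j _ => ?_
      rw [integral_finsetSum _ fun l _ => ((hint j l).mul_const _).const_mul _, Finset.mul_sum]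
      refine Finset.sum_congr rfl fun l _ => ?_
      rw [integral_const_mul, integral_mul_const]
    rw [this]
    exact integral_nonneg fun ω => sq_nonneg _

theorem integral_mul_sub_dotProduct {Q P : Type*} [Fintype P] {A : Set Ω} {w : Ω → Q → ℝ}
    {r : Ω → P → ℝ} {Y : Ω → ℝ} {j : Q} (hY : Integrable (fun ω => w ω j * Y ω) (μ[|A]))
    (hr : ∀ l, Integrable (fun ω => w ω j * r ω l) (μ[|A])) (θ : P → ℝ) :
    ∫ ω, w ω j * (Y ω - r ω ⬝ᵥ θ) ∂(μ[|A])
      = ∫ ω, w ω j * Y ω ∂(μ[|A]) - (condMoment μ A w r *ᵥ θ) j := by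
  have e : ∀ ω, w ω j * (Y ω - r ω ⬝ᵥ θ) = w ω j * Y ω - ∑ l, w ω j * r ω l * θ l := by
    intro ω
    rw [dotProduct, mul_sub, Finset.mul_sum]
    simp only [mul_assoc]
  simp only [e]
  rw [integral_sub hY (integrable_finsetSum _ fun l _ => (hr l).mul_const _),
    integral_finsetSum _ fun l _ => (hr l).mul_const _]
  simp only [integral_mul_const]
  rfl

theorem measure_ne_zero_of_rank_condMoment {Q P : Type*} [Fintype P] {A : Set Ω}
    {w : Ω → Q → ℝ} {r : Ω → P → ℝ} {n : ℕ} (h : (condMoment μ A w r).rank = n + 1) : μ A ≠ 0 := by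
  intro h0
  have : condMoment μ A w r = 0 := by
    ext j l
    simp [condMoment, cond_eq_zero_of_meas_eq_zero h0]
  rw [this, Matrix.rank_zero] at h
  omega

theorem integrable_cond_iff [IsFiniteMeasure μ] {A : Set Ω} (hA : μ A ≠ 0) {f : Ω → ℝ} :
    Integrable f (μ[|A]) ↔ IntegrableOn f A μ :=
  integrable_smul_measure (ENNReal.inv_ne_zero.2 (measure_ne_top μ A)) (ENNReal.inv_ne_top.2 hA)

theorem setIntegral_eq_mul_integral_cond [IsFiniteMeasure μ] {A : Set Ω} (hA : μ A ≠ 0)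
    (f : Ω → ℝ) : ∫ ω in A, f ω ∂μ = μ.real A * ∫ ω, f ω ∂(μ[|A]) := by
  rw [integral_cond_eq_inv_mul, mul_inv_cancel_left₀]
  exact (ENNReal.toReal_pos hA (measure_ne_top μ A)).ne'

omit [MeasurableSpace Ω] in
theorem bothPos_censor (y y' : Ω → ℝ) : bothPos (censor y) (censor y') = bothPos y y' := by
  ext ω
  simp [bothPos, censor]

theorem ivOutcome_sub_dotProduct_ivParam {T d : ℕ} (k m : ℕ) (y y' : ℝ) (x x' β : Fin d → ℝ)
    (S : Matrix (Fin T) (Fin T) ℝ) (t s : Fin T) :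
    ivOutcome k m y y' - ivRegressor k m y y' x x' ⬝ᵥ ivParam β S t s
      = residual k m y y' ((x - x') ⬝ᵥ β) (S t t - S t s) (S s s - S t s) := by
  simp only [ivOutcome, ivRegressor, ivParam, residual, sumElim_dotProduct_sumElim,
    smul_dotProduct, smul_eq_mul]
  simp
  ring

variable [IsProbabilityMeasure μ] {T d q : ℕ} {β : Fin d → ℝ} {x : Fin T → Ω → Fin d → ℝ}
  {α : Ω → ℝ} {ε : Fin T → Ω → ℝ} {S : Matrix (Fin T) (Fin T) ℝ} {yl y : Fin T → Ω → ℝ}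

/-- The instrumental variables moments are satisfied by the true parameter. -/
theorem NormalErrors.integral_mul_ivOutcome (hx : ∀ t, Measurable (x t))
    (hα : Measurable α) (hyl : ∀ t, yl t = latent β (x t) α (ε t)) (hy : ∀ t, y t = censor (yl t))
    (h : NormalErrors μ (fun ω => (α ω, fun t => x t ω)) ε S) {t s : Fin T} (hts : t ≠ s)
    {k m : ℕ} (hk : 1 ≤ k) (hm : 1 ≤ m) {g : (Fin d → ℝ) × (Fin d → ℝ) → Fin q → ℝ}
    (hg : Measurable g) {w : Ω → Fin q → ℝ} {r : Ω → Fin d ⊕ Fin 2 → ℝ} {Y : Ω → ℝ}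
    (hw : ∀ ω, w ω = g (x t ω, x s ω))
    (hr : ∀ ω, r ω = ivRegressor k m (y t ω) (y s ω) (x t ω) (x s ω))
    (hY : ∀ ω, Y ω = ivOutcome k m (y t ω) (y s ω))
    (hwY : ∀ j, Integrable (fun ω => w ω j * Y ω) (μ[|bothPos (y t) (y s)]))
    (hwr : ∀ j l, Integrable (fun ω => w ω j * r ω l) (μ[|bothPos (y t) (y s)])) (j : Fin q) :
    ∫ ω, w ω j * Y ω ∂(μ[|bothPos (y t) (y s)])
      = (condMoment μ (bothPos (y t) (y s)) w r *ᵥ ivParam β S t s) j := by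
  rw [← sub_eq_zero, ← integral_mul_sub_dotProduct (hwY j) (hwr j), integral_cond_eq_inv_mul]
  have hylm : ∀ t, Measurable (yl t) := fun t => by
    rw [hyl]
    exact ((measurable_dotProduct_const (hx t) β).add hα).add (h.measurable t)
  have hA : bothPos (y t) (y s) = bothPos (yl t) (yl s) := by rw [hy, hy, bothPos_censor]
  have key := h.setIntegral_mul_residual_eq_zero hx hα hyl hts hk hm
    ((measurable_pi_apply j).comp hg)
  rw [hA, mul_eq_zero]
  right
  rw [← key]
  refine setIntegral_congr_fun (measurableSet_bothPos (hylm t) (hylm s)) fun ω hω => ?_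
  have e1 : y t ω = yl t ω := by rw [hy]; exact max_eq_right hω.1.le
  have e2 : y s ω = yl s ω := by rw [hy]; exact max_eq_right hω.2.le
  simp only [hw, hr, hY, ivOutcome_sub_dotProduct_ivParam, e1, e2, Function.comp]

theorem NormalErrors.iv_identification (hx : ∀ t, Measurable (x t))
    (hα : Measurable α) (hyl : ∀ t, yl t = latent β (x t) α (ε t)) (hy : ∀ t, y t = censor (yl t))
    (h : NormalErrors μ (fun ω => (α ω, fun t => x t ω)) ε S) {t s : Fin T} (hts : t ≠ s)
    {k m : ℕ} (hk : 1 ≤ k) (hm : 1 ≤ m) {g : (Fin d → ℝ) × (Fin d → ℝ) → Fin q → ℝ}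
    (hg : Measurable g) {w : Ω → Fin q → ℝ} {r : Ω → Fin d ⊕ Fin 2 → ℝ} {Y : Ω → ℝ}
    (hw : ∀ ω, w ω = g (x t ω, x s ω))
    (hr : ∀ ω, r ω = ivRegressor k m (y t ω) (y s ω) (x t ω) (x s ω))
    (hY : ∀ ω, Y ω = ivOutcome k m (y t ω) (y s ω))
    (hwY : ∀ j, Integrable (fun ω => w ω j * Y ω) (μ[|bothPos (y t) (y s)]))
    (hwr : ∀ j l, Integrable (fun ω => w ω j * r ω l) (μ[|bothPos (y t) (y s)]))
    (hrank : (condMoment μ (bothPos (y t) (y s)) w r).rank = d + 2) (θ : Fin d ⊕ Fin 2 → ℝ) :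
    (∀ j, ∫ ω, w ω j * (Y ω - r ω ⬝ᵥ θ) ∂(μ[|bothPos (y t) (y s)]) = 0)
      ↔ θ = ivParam β S t s := by
  have hinj := mulVec_injective_of_rank_eq_card
    (M := condMoment μ (bothPos (y t) (y s)) w r) (by simpa using hrank)
  rw [← hinj.eq_iff, funext_iff]
  refine forall_congr' fun j => ?_
  rw [integral_mul_sub_dotProduct (hwY j) (hwr j),
    h.integral_mul_ivOutcome hx hα hyl hy hts hk hm hg hw hr hY hwY hwr j, sub_eq_zero, eq_comm]

end PanelTobit

namespace PanelTobit

variable {Ω : Type*} [MeasurableSpace Ω] {μ : Measure Ω} [IsProbabilityMeasure μ]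

omit [IsProbabilityMeasure μ] in
/-- Strong law of large numbers for the sum of `f (V i)` over the `i` with `V i ∈ A`. -/
theorem tendsto_inv_mul_sum_indicator {𝓥 : Type*} [MeasurableSpace 𝓥] {V : ℕ → Ω → 𝓥}
    (hV : ∀ i, Measurable (V i)) (hind : iIndepFun V μ)
    (hid : ∀ i, IdentDistrib (V i) (V 0) μ μ) {A : Set 𝓥} (hA : MeasurableSet A) {f : 𝓥 → ℝ}
    (hf : Measurable f) (hint : IntegrableOn (fun ω => f (V 0 ω)) (V 0 ⁻¹' A) μ) :
    ∀ᵐ ω ∂μ, Tendsto (fun N : ℕ => (N : ℝ)⁻¹ * ∑ i ∈ Finset.range N, A.indicator f (V i ω)) atTop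
      (𝓝 (∫ ω in V 0 ⁻¹' A, f (V 0 ω) ∂μ)) := by
  have hfA : Measurable (A.indicator f) := hf.indicator hA
  have h0 : (fun ω => A.indicator f (V 0 ω)) = (V 0 ⁻¹' A).indicator fun ω => f (V 0 ω) := by
    funext ω
    by_cases h : V 0 ω ∈ A <;> simp [Set.indicator, h]
  have h := strong_law_ae_real (fun i ω => A.indicator f (V i ω))
    (by simpa only [h0] using hint.integrable_indicator (hV 0 hA))
    (fun i j hij => (hind.indepFun hij).comp hfA hfA) fun i => (hid i).comp hfA
  rw [h0, integral_indicator (hV 0 hA)] at h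
  simpa only [div_eq_inv_mul] using h

variable {T d q : ℕ} {β : Fin d → ℝ} {x : ℕ → Fin T → Ω → Fin d → ℝ}
  {α : ℕ → Ω → ℝ} {ε : ℕ → Fin T → Ω → ℝ} {S : Matrix (Fin T) (Fin T) ℝ} {yl y : ℕ → Fin T → Ω → ℝ}

/-- The censored outcome as a function of the fixed effect, the regressors and the errors. -/
noncomputable def outcome (β : Fin d → ℝ) (t : Fin T)
    (v : ℝ × (Fin T → Fin d → ℝ) × (Fin T → ℝ)) : ℝ := max 0 (v.2.1 t ⬝ᵥ β + v.1 + v.2.2 t)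

@[fun_prop]
theorem measurable_outcome (β : Fin d → ℝ) (t : Fin T) :
    Measurable (outcome β t : ℝ × (Fin T → Fin d → ℝ) × (Fin T → ℝ) → ℝ) :=
  measurable_const.max (((measurable_dotProduct_const (by fun_prop) β).add (by fun_prop)).add
    (by fun_prop))

theorem measurable_ivRegressor {𝓥 : Type*} [MeasurableSpace 𝓥] (k m : ℕ) {a b : 𝓥 → ℝ}
    {u v : 𝓥 → Fin d → ℝ} (ha : Measurable a) (hb : Measurable b) (hu : Measurable u)
    (hv : Measurable v) (l : Fin d ⊕ Fin 2) :
    Measurable fun z => ivRegressor k m (a z) (b z) (u z) (v z) l := by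
  rcases l with l | l
  · simp only [ivRegressor, Sum.elim_inl, Pi.smul_apply, Pi.sub_apply, smul_eq_mul]
    fun_prop
  · fin_cases l
    · simp only [ivRegressor, Sum.elim_inr, Fin.zero_eta, Matrix.cons_val_zero]
      fun_prop
    · simp only [ivRegressor, Sum.elim_inr, Fin.mk_one, Matrix.cons_val_one, Matrix.cons_val_fin_one]
      fun_prop

theorem tendsto_ivEstimator (hx : ∀ i t, Measurable (x i t)) (hα : ∀ i, Measurable (α i))
    (hyl : ∀ i t, yl i t = latent β (x i t) (α i) (ε i t)) (hy : ∀ i t, y i t = censor (yl i t))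
    (h : ∀ i, NormalErrors μ (fun ω => (α i ω, fun t => x i t ω)) (ε i) S) {t s : Fin T}
    (hts : t ≠ s) {k m : ℕ} (hk : 1 ≤ k) (hm : 1 ≤ m)
    {g : (Fin d → ℝ) × (Fin d → ℝ) → Fin q → ℝ} (hg : Measurable g) {w : ℕ → Ω → Fin q → ℝ}
    {r : ℕ → Ω → Fin d ⊕ Fin 2 → ℝ} {Y : ℕ → Ω → ℝ} (hw : ∀ i ω, w i ω = g (x i t ω, x i s ω))
    (hr : ∀ i ω, r i ω = ivRegressor k m (y i t ω) (y i s ω) (x i t ω) (x i s ω))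
    (hY : ∀ i ω, Y i ω = ivOutcome k m (y i t ω) (y i s ω))
    (hwY : ∀ j, Integrable (fun ω => w 0 ω j * Y 0 ω) (μ[|bothPos (y 0 t) (y 0 s)]))
    (hwr : ∀ j l, Integrable (fun ω => w 0 ω j * r 0 ω l) (μ[|bothPos (y 0 t) (y 0 s)]))
    (hind : iIndepFun (fun i ω => (α i ω, (fun t => x i t ω), fun t => ε i t ω)) μ)
    (hid : ∀ i, IdentDistrib (fun ω => (α i ω, (fun t => x i t ω), fun t => ε i t ω))
      (fun ω => (α 0 ω, (fun t => x 0 t ω), fun t => ε 0 t ω)) μ μ)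
    (hww : ∀ j l, Integrable (fun ω => w 0 ω j * w 0 ω l) (μ[|bothPos (y 0 t) (y 0 s)]))
    (hdet : (condMoment μ (bothPos (y 0 t) (y 0 s)) (w 0) (w 0)).det ≠ 0)
    (hrank : (condMoment μ (bothPos (y 0 t) (y 0 s)) (w 0) (r 0)).rank = d + 2) :
    ∀ᵐ ω ∂μ, Tendsto (fun N : ℕ =>
      ivEstimator ((Finset.range N).filter fun i => 0 < y i t ω ∧ 0 < y i s ω)
        (fun i => w i ω) (fun i => r i ω) (fun i => Y i ω)) atTop (𝓝 (ivParam β S t s)) := by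
  set E : Set Ω := bothPos (y 0 t) (y 0 s) with hE
  have hE0 : μ E ≠ 0 := measure_ne_zero_of_rank_condMoment hrank
  have hP : μ.real E ≠ 0 := (ENNReal.toReal_pos hE0 (measure_ne_top μ E)).ne'
  let V : ℕ → Ω → ℝ × (Fin T → Fin d → ℝ) × (Fin T → ℝ) :=
    fun i ω => (α i ω, (fun t => x i t ω), fun t => ε i t ω)
  have hV : ∀ i, Measurable (V i) := fun i => (hα i).prodMk
    ((measurable_pi_lambda _ (hx i)).prodMk (measurable_pi_lambda _ (h i).measurable))
  have hyV : ∀ i t ω, y i t ω = outcome β t (V i ω) := fun i t ω => by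
    rw [hy, hyl]; rfl
  let A : Set (ℝ × (Fin T → Fin d → ℝ) × (Fin T → ℝ)) := bothPos (outcome β t) (outcome β s)
  have hA : MeasurableSet A :=
    measurableSet_bothPos (measurable_outcome β t) (measurable_outcome β s)
  have hEA : E = V 0 ⁻¹' A := by
    ext ω
    simp only [hE, A, bothPos, Set.mem_ofPred_eq, Set.mem_preimage, hyV]
  let wV : ℝ × (Fin T → Fin d → ℝ) × (Fin T → ℝ) → Fin q → ℝ := fun v => g (v.2.1 t, v.2.1 s)
  let rV : ℝ × (Fin T → Fin d → ℝ) × (Fin T → ℝ) → Fin d ⊕ Fin 2 → ℝ := fun v =>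
    ivRegressor k m (outcome β t v) (outcome β s v) (v.2.1 t) (v.2.1 s)
  let YV : ℝ × (Fin T → Fin d → ℝ) × (Fin T → ℝ) → ℝ := fun v =>
    ivOutcome k m (outcome β t v) (outcome β s v)
  have hwm : ∀ j, Measurable fun v => wV v j := fun j =>
    (measurable_pi_apply j).comp (hg.comp (by fun_prop))
  have hrm : ∀ l, Measurable fun v => rV v l := fun l =>
    measurable_ivRegressor k m (measurable_outcome β t) (measurable_outcome β s) (by fun_prop)
      (by fun_prop) l
  have hYm : Measurable YV := by
    simp only [YV, ivOutcome]
    fun_prop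
  have hwV : ∀ i ω, w i ω = wV (V i ω) := fun i ω => hw i ω
  have hrV : ∀ i ω, r i ω = rV (V i ω) := fun i ω => by rw [hr, hyV, hyV]
  have hYV : ∀ i ω, Y i ω = YV (V i ω) := fun i ω => by rw [hY, hyV, hyV]
  have slln : ∀ (f : ℝ × (Fin T → Fin d → ℝ) × (Fin T → ℝ) → ℝ) (f' : ℕ → Ω → ℝ), Measurable f →
      (∀ i ω, f' i ω = f (V i ω)) → Integrable (f' 0) (μ[|E]) →
      ∀ᵐ ω ∂μ, Tendsto (fun N : ℕ => (N : ℝ)⁻¹ *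
        ∑ i ∈ (Finset.range N).filter (fun i => 0 < y i t ω ∧ 0 < y i s ω), f' i ω) atTop
        (𝓝 (μ.real E * ∫ ω, f' 0 ω ∂(μ[|E]))) := by
    intro f f' hf hff' hint
    rw [integrable_cond_iff hE0] at hint
    have e0 : f' 0 = fun ω => f (V 0 ω) := funext (hff' 0)
    have := tendsto_inv_mul_sum_indicator hV hind hid hA hf (by rw [← hEA, ← e0]; exact hint)
    filter_upwards [this] with ω hω
    rw [← setIntegral_eq_mul_integral_cond hE0, e0, hEA]
    refine hω.congr fun N => ?_
    rw [Finset.sum_filter]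
    refine congrArg _ (Finset.sum_congr rfl fun i _ => ?_)
    simp only [Set.indicator, A, bothPos, Set.mem_ofPred_eq, hyV, hff']
  have hAA := ae_all_iff.2 fun j => ae_all_iff.2 fun l => slln (fun v => wV v j * wV v l)
    (fun i ω => w i ω j * w i ω l) ((hwm j).mul (hwm l)) (fun i ω => by rw [hwV]) (hww j l)
  have hBB := ae_all_iff.2 fun j => ae_all_iff.2 fun l => slln (fun v => wV v j * rV v l)
    (fun i ω => w i ω j * r i ω l) ((hwm j).mul (hrm l)) (fun i ω => by rw [hwV, hrV]) (hwr j l)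
  have hcc := ae_all_iff.2 fun j => slln (fun v => wV v j * YV v)
    (fun i ω => w i ω j * Y i ω) ((hwm j).mul hYm) (fun i ω => by rw [hwV, hYV]) (hwY j)
  have hpsd := posSemidef_condMoment hww
  have hinj := mulVec_injective_of_rank_eq_card
    (M := condMoment μ E (w 0) (r 0)) (by simpa using hrank)
  have hmom : (fun j => ∫ ω, w 0 ω j * Y 0 ω ∂(μ[|E]))
      = condMoment μ E (w 0) (r 0) *ᵥ ivParam β S t s := funext fun j =>
    (h 0).integral_mul_ivOutcome (hx 0) (hα 0) (hyl 0) (hy 0) hts hk hm hg (hw 0) (hr 0) (hY 0)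
      hwY hwr j
  filter_upwards [hAA, hBB, hcc] with ω hA' hB' hc'
  let I : ℕ → Finset ℕ := fun N => (Finset.range N).filter fun i => 0 < y i t ω ∧ 0 < y i s ω
  have hA1 : Tendsto (fun N : ℕ => ((μ.real E)⁻¹ * (N : ℝ)⁻¹) •
      ∑ i ∈ I N, Matrix.vecMulVec (w i ω) (w i ω)) atTop (𝓝 (condMoment μ E (w 0) (w 0))) := by
    refine tendsto_pi_nhds.2 fun j => tendsto_pi_nhds.2 fun l => ?_
    have := (hA' j l).const_mul (μ.real E)⁻¹
    rw [inv_mul_cancel_left₀ hP] at this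
    simpa only [condMoment, Matrix.of_apply, I, Matrix.smul_apply, Matrix.sum_apply,
      Matrix.vecMulVec_apply, smul_eq_mul, mul_assoc] using this
  have hB1 : Tendsto (fun N : ℕ => ((μ.real E)⁻¹ * (N : ℝ)⁻¹) •
      ∑ i ∈ I N, Matrix.vecMulVec (w i ω) (r i ω)) atTop (𝓝 (condMoment μ E (w 0) (r 0))) := by
    refine tendsto_pi_nhds.2 fun j => tendsto_pi_nhds.2 fun l => ?_
    have := (hB' j l).const_mul (μ.real E)⁻¹
    rw [inv_mul_cancel_left₀ hP] at this
    simpa only [condMoment, Matrix.of_apply, I, Matrix.smul_apply, Matrix.sum_apply,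
      Matrix.vecMulVec_apply, smul_eq_mul, mul_assoc] using this
  have hc1 : Tendsto (fun N : ℕ => ((μ.real E)⁻¹ * (N : ℝ)⁻¹) • ∑ i ∈ I N, Y i ω • w i ω) atTop
      (𝓝 (condMoment μ E (w 0) (r 0) *ᵥ ivParam β S t s)) := by
    rw [← hmom]
    refine tendsto_pi_nhds.2 fun j => ?_
    have := (hc' j).const_mul (μ.real E)⁻¹
    rw [inv_mul_cancel_left₀ hP] at this
    simpa only [Pi.smul_apply, Finset.sum_apply, smul_eq_mul, mul_assoc, mul_comm (Y _ ω)]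
      using this
  refine (tendsto_twoStage hA1 hB1 hc1 hpsd hdet hinj).congr' ?_
  filter_upwards [eventually_ne_atTop 0] with N hN
  exact twoStage_smul (mul_ne_zero (inv_ne_zero hP) (inv_ne_zero (Nat.cast_ne_zero.2 hN))) _ _ _

end PanelTobit

open PanelTobit in
theorem mainTheorem2 {Ω : Type*} [MeasurableSpace Ω] (μ : Measure Ω) [IsProbabilityMeasure μ]
    {T d : ℕ} (β : Fin d → ℝ)
    -- regressors, fixed effects and errors of the individuals `i = 0, 1, 2, …`
    (x : ℕ → Fin T → Ω → Fin d → ℝ) (α : ℕ → Ω → ℝ) (ε : ℕ → Fin T → Ω → ℝ)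
    (hx : ∀ i t, Measurable (x i t)) (hα : ∀ i, Measurable (α i)) :
    -- (1) Non-stationary errors
    (∀ (S : Matrix (Fin T) (Fin T) ℝ) (yl y : ℕ → Fin T → Ω → ℝ),
      (∀ i t, yl i t = latent β (x i t) (α i) (ε i t)) →
      (∀ i t, y i t = censor (yl i t)) →
      (∀ i, NormalErrors μ (fun ω => (α i ω, fun t => x i t ω)) (ε i) S) →
      ∀ t s : Fin T, t ≠ s → ∀ k m : ℕ, 1 ≤ k → 1 ≤ m →
      -- (1a) the moment condition
      (∀ (i : ℕ) (ξ : Ω → ℝ),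
        (∀ ω, ξ ω = residual k m (yl i t ω) (yl i s ω) ((x i t ω - x i s ω) ⬝ᵥ β)
          (S t t - S t s) (S s s - S t s)) →
        Integrable ξ (μ[|bothPos (yl i t) (yl i s)]) →
        CondMeanZero μ (bothPos (yl i t) (yl i s)) (fun ω => (x i t ω, x i s ω)) ξ) ∧
      -- instruments that are functions of `(x_t, x_s)`; all outcomes below are the observed ones
      (∀ (q : ℕ) (g : (Fin d → ℝ) × (Fin d → ℝ) → Fin q → ℝ), Measurable g →
        ∀ (w : ℕ → Ω → Fin q → ℝ) (r : ℕ → Ω → Fin d ⊕ Fin 2 → ℝ) (Y : ℕ → Ω → ℝ),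
        (∀ i ω, w i ω = g (x i t ω, x i s ω)) →
        (∀ i ω, r i ω = ivRegressor k m (y i t ω) (y i s ω) (x i t ω) (x i s ω)) →
        (∀ i ω, Y i ω = ivOutcome k m (y i t ω) (y i s ω)) →
        (∀ i j, Integrable (fun ω => w i ω j * Y i ω) (μ[|bothPos (y i t) (y i s)])) →
        (∀ i j l, Integrable (fun ω => w i ω j * r i ω l) (μ[|bothPos (y i t) (y i s)])) →
        -- (1b) identification: under the rank condition the true parameter is the only solution
        -- of the instrumental variables moment equations
        (∀ i, (condMoment μ (bothPos (y i t) (y i s)) (w i) (r i)).rank = d + 2 →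
          ∀ θ : Fin d ⊕ Fin 2 → ℝ,
            (∀ j, ∫ ω, w i ω j * (Y i ω - r i ω ⬝ᵥ θ) ∂(μ[|bothPos (y i t) (y i s)]) = 0)
              ↔ θ = ivParam β S t s) ∧
        -- (1c) consistency of the instrumental variables estimator under random sampling
        (iIndepFun (fun i ω => (α i ω, (fun t => x i t ω), fun t => ε i t ω)) μ →
          (∀ i, IdentDistrib (fun ω => (α i ω, (fun t => x i t ω), fun t => ε i t ω))
            (fun ω => (α 0 ω, (fun t => x 0 t ω), fun t => ε 0 t ω)) μ μ) →
          (∀ j l, Integrable (fun ω => w 0 ω j * w 0 ω l) (μ[|bothPos (y 0 t) (y 0 s)])) →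
          (condMoment μ (bothPos (y 0 t) (y 0 s)) (w 0) (w 0)).det ≠ 0 →
          (condMoment μ (bothPos (y 0 t) (y 0 s)) (w 0) (r 0)).rank = d + 2 →
          ∀ᵐ ω ∂μ, Tendsto (fun N : ℕ =>
            ivEstimator ((Finset.range N).filter fun i => 0 < y i t ω ∧ 0 < y i s ω)
              (fun i => w i ω) (fun i => r i ω) (fun i => Y i ω))
            atTop (𝓝 (ivParam β S t s))))) ∧
    -- (2) Factor loadings
    (∀ (S : Matrix (Fin T) (Fin T) ℝ) (ρ : Fin T → ℝ) (i : ℕ) (yl : Fin T → Ω → ℝ),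
      (∀ t, yl t = latent β (x i t) (fun ω => ρ t * α i ω) (ε i t)) →
      NormalErrors μ (fun ω => (α i ω, fun t => x i t ω)) (ε i) S →
      ∀ t s : Fin T, t ≠ s → ρ s ≠ 0 → ∀ k m : ℕ, 1 ≤ k → 1 ≤ m →
      ∀ ξ : Ω → ℝ,
        (∀ ω, ξ ω = loadingResidual k m (ρ t / ρ s) (yl t ω) (yl s ω)
          ((x i t ω - (ρ t / ρ s) • x i s ω) ⬝ᵥ β)
          (S t t - S t s * (ρ t / ρ s)) (S s s * (ρ t / ρ s) - S t s)) →
        Integrable ξ (μ[|bothPos (yl t) (yl s)]) →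
        CondMeanZero μ (bothPos (yl t) (yl s)) (fun ω => (x i t ω, x i s ω)) ξ) ∧
    -- (3) Individual-specific variances, errors i.i.d. over time: `σ_i² = a`
    (∀ (a : Ω → ℝ) (i : ℕ) (yl : Fin T → Ω → ℝ),
      (∀ t, yl t = latent β (x i t) (α i) (ε i t)) →
      IndividualVarianceErrors μ (fun ω => (α i ω, fun t => x i t ω)) a 0 (ε i) →
      (∀ t s : Fin T, t ≠ s → ∀ k m : ℕ, 1 ≤ k → 1 ≤ m →
        ∀ ξ : Ω → ℝ,
          (∀ ω, ξ ω = residual k m (yl t ω) (yl s ω) ((x i t ω - x i s ω) ⬝ᵥ β) (a ω) (a ω)) →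
          Integrable ξ (μ[|bothPos (yl t) (yl s)]) →
          CondMeanZero μ (bothPos (yl t) (yl s)) (fun ω => (x i t ω, x i s ω)) ξ) ∧
      (∀ t s τ : Fin T, t ≠ s → s ≠ τ → t ≠ τ →
        ∀ ξ : Ω → ℝ,
          (∀ ω, ξ ω = tripleLhs (yl t ω) (yl s ω) (yl τ ω)
            - tripleReg β (yl t ω) (yl s ω) (yl τ ω) (x i t ω) (x i s ω) (x i τ ω)) →
          Integrable ξ (μ[|allPos (yl t) (yl s) (yl τ)]) →
          CondMeanZero μ (allPos (yl t) (yl s) (yl τ))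
            (fun ω => (x i t ω, x i s ω, x i τ ω)) ξ)) ∧
    -- (4) Additive individual- and time-specific variances: `σ_it² = a + v t`
    (∀ (a : Ω → ℝ) (v : Fin T → ℝ) (i : ℕ) (yl : Fin T → Ω → ℝ),
      (∀ t, yl t = latent β (x i t) (α i) (ε i t)) →
      IndividualVarianceErrors μ (fun ω => (α i ω, fun t => x i t ω)) a v (ε i) →
      (∀ t s : Fin T, t ≠ s → ∀ k m : ℕ, 1 ≤ k → 1 ≤ m →
        ∀ ξ : Ω → ℝ,
          (∀ ω, ξ ω = residual k m (yl t ω) (yl s ω) ((x i t ω - x i s ω) ⬝ᵥ β)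
            (a ω + v t) (a ω + v s)) →
          Integrable ξ (μ[|bothPos (yl t) (yl s)]) →
          CondMeanZero μ (bothPos (yl t) (yl s)) (fun ω => (x i t ω, x i s ω)) ξ) ∧
      (∀ t s τ : Fin T, t ≠ s → s ≠ τ → t ≠ τ →
        ∀ ξ : Ω → ℝ,
          (∀ ω, ξ ω = tripleLhs (yl t ω) (yl s ω) (yl τ ω)
            - (tripleReg β (yl t ω) (yl s ω) (yl τ ω) (x i t ω) (x i s ω) (x i τ ω)
              + (yl τ ω - yl t ω) * v s + (yl s ω - yl τ ω) * v t
              + (yl t ω - yl s ω) * v τ)) →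
          Integrable ξ (μ[|allPos (yl t) (yl s) (yl τ)]) →
          CondMeanZero μ (allPos (yl t) (yl s) (yl τ))
            (fun ω => (x i t ω, x i s ω, x i τ ω)) ξ)) ∧
    -- (5) Fixed effects in the slopes
    (∀ (S : Matrix (Fin T) (Fin T) ℝ) (z : Fin T → Ω → ℝ) (i : ℕ) (yl : Fin T → Ω → ℝ),
      (∀ t, Measurable (z t)) →
      (∀ t, yl t = latent β (x i t) (fun ω => z t ω * α i ω) (ε i t)) →
      NormalErrors μ (fun ω => (α i ω, (fun t => x i t ω), fun t => z t ω)) (ε i) S →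
      ∀ t s : Fin T, t ≠ s → ∀ k m : ℕ, 1 ≤ k → 1 ≤ m →
      ∀ ξ : Ω → ℝ,
        (∀ ω, ξ ω = residual k m (yl t ω * z s ω) (yl s ω * z t ω)
          ((z s ω • x i t ω - z t ω • x i s ω) ⬝ᵥ β)
          (z s ω ^ 2 * S t t - z t ω * z s ω * S t s)
          (z t ω ^ 2 * S s s - z t ω * z s ω * S t s)) →
        Integrable ξ (μ[|bothPos (yl t) (yl s)]) →
        CondMeanZero μ (bothPos (yl t) (yl s))
          (fun ω => (z t ω, z s ω, x i t ω, x i s ω)) ξ) := by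
  refine ⟨?_, ?_, ?_, ?_, ?_⟩
  · intro S yl y hyl hy h t s hts k m hk hm
    refine ⟨fun i ξ hξ hint => (h i).condMeanZero_residual (hx i) (hα i) (hyl i) hts hk hm hξ hint,
      fun q g hg w r Y hw hr hY hwY hwr => ⟨fun i hrank θ => ?_, fun hind hid hww hdet hrank => ?_⟩⟩
    · exact (h i).iv_identification (hx i) (hα i) (hyl i) (hy i) hts hk hm hg (hw i) (hr i) (hY i)
        (hwY i) (hwr i) hrank θ
    · exact tendsto_ivEstimator hx hα hyl hy h hts hk hm hg hw hr hY (hwY 0) (hwr 0) hind hid hww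
        hdet hrank
  · intro S ρ i yl hyl h t s hts hρ k m hk hm ξ hξ hint
    exact h.condMeanZero_loadingResidual (hx i) (hα i) hyl hts hρ hk hm hξ hint
  · intro a i yl hyl h
    refine ⟨fun t s hts k m hk hm ξ hξ hint => ?_, fun t s τ hts hsτ htτ ξ hξ hint => ?_⟩
    · exact h.condMeanZero_residual (hx i) (hα i) hyl hts hk hm (by simpa using hξ) hint
    · exact h.condMeanZero_triple (hx i) (hα i) hyl hts hsτ htτ (by simpa using hξ) hint
  · intro a v i yl hyl h
    exact ⟨fun t s hts k m hk hm ξ hξ hint =>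
        h.condMeanZero_residual (hx i) (hα i) hyl hts hk hm hξ hint,
      fun t s τ hts hsτ htτ ξ hξ hint =>
        h.condMeanZero_triple (hx i) (hα i) hyl hts hsτ htτ hξ hint⟩
  · intro S z i yl hz hyl h t s hts k m hk hm ξ hξ hint
    exact h.condMeanZero_slopeResidual (hx i) (hα i) hz hyl hts hk hm hξ hint
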